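/- All graphs are finite and simple, and the girth of a graph is the length of its shortest cycle. For an integer $k\ge 3$, a graph is $C_k$-colorable if it admits a homomorphism to the cycle $C_k$ of length $k$. Let $f(k)$ be the smallest integer $m\ge 0$ such that every planar graph of girth $k$ without cycles of length from $k+1$ to $m$ is $C_k$-colorable (with $f(k)=\infty$ if no such $m$ exists). If $f(5)\le 17$, then every planar graph is (properly) $5$-colorable. -/

import Mathlib

/-- The Euclidean plane. -/
abbrev Plane : Type := EuclideanSpace ℝ (Fin 2)

/-- `A` is a polygonal arc with ends `x` and `y`: a union of finitely many nondegenerate straight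
line segments `[p 0, p 1], …, [p (n - 1), p n]` with `p 0 = x` and `p n = y`, in which two
consecutive segments meet only in their common end and any other two segments are disjoint
(only the values `p 0, …, p n` matter). -/
def IsPolygonalArc (A : Set Plane) (x y : Plane) : Prop :=
  ∃ (n : ℕ) (p : ℕ → Plane),
    1 ≤ n ∧ p 0 = x ∧ p n = y ∧
    A = ⋃ i ∈ Set.Iio n, segment ℝ (p i) (p (i + 1)) ∧
    (∀ i < n, p i ≠ p (i + 1)) ∧
    (∀ i, i + 1 < n →
      segment ℝ (p i) (p (i + 1)) ∩ segment ℝ (p (i + 1)) (p (i + 2)) = {p (i + 1)}) ∧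
    (∀ i j, i + 1 < j → j < n →
      Disjoint (segment ℝ (p i) (p (i + 1))) (segment ℝ (p j) (p (j + 1))))

/-- A drawing of `G` in the plane without crossings: vertices are distinct points, every edge is a
polygonal arc joining its ends, and the interior of an edge contains no vertex and no point of any
other edge. -/
structure PlaneDrawing {V : Type*} (G : SimpleGraph V) where
  /-- The point that represents a vertex. -/
  pos : V → Plane
  /-- The arc that represents an edge (its values on non-edges are irrelevant). -/
  arc : Sym2 V → Set Plane
  pos_injective : Function.Injective pos
  isPolygonalArc : ∀ u v, G.Adj u v → IsPolygonalArc (arc s(u, v)) (pos u) (pos v)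
  vertex_mem_arc : ∀ e ∈ G.edgeSet, ∀ w, pos w ∈ arc e → w ∈ e
  arc_inter_arc : ∀ e ∈ G.edgeSet, ∀ e' ∈ G.edgeSet, e ≠ e' → arc e ∩ arc e' ⊆ Set.range pos

/-- A graph is planar if it can be drawn in the plane without crossings. -/
def IsPlanar {V : Type*} (G : SimpleGraph V) : Prop :=
  Nonempty (PlaneDrawing G)

/-- `G` has no cycle whose length lies between `a` and `b` (inclusive). -/
def NoCycleOfLength {V : Type*} (G : SimpleGraph V) (a b : ℕ) : Prop :=
  ∀ (v : V) (c : G.Walk v v), c.IsCycle → ¬ (a ≤ c.length ∧ c.length ≤ b)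

/-- `G` is `C_k`-colorable: it admits a homomorphism to the cycle of length `k`. -/
def IsCycleColorable {V : Type*} (G : SimpleGraph V) (k : ℕ) : Prop :=
  Nonempty (G →g SimpleGraph.cycleGraph k)

/-- Every finite planar graph of girth `k` without cycles of length from `k + 1` to `m` is
`C_k`-colorable. -/
def SteinbergProperty (k m : ℕ) : Prop :=
  ∀ (V : Type) [Finite V] (G : SimpleGraph V),
    IsPlanar G → G.egirth = k → NoCycleOfLength G (k + 1) m → IsCycleColorable G k

/-- `f(k)`: the smallest `m` such that every planar graph of girth `k` without cycles of length
from `k + 1` to `m` is `C_k`-colorable, and `⊤` if there is no such `m`. -/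
noncomputable def steinbergNumber (k : ℕ) : ℕ∞ :=
  ⨅ (m : ℕ) (_ : SteinbergProperty k m), (m : ℕ∞)

/-!
Replace every edge of a planar graph by a chain of three pentagons. The result is planar: doubling
the edges of a plane drawing by parallel copies and subdividing keeps it planar, and these two
operations suffice. Apart from the pentagons themselves, a cycle of the new graph projects to a
cycle of the old one, of length at least three, and crosses three pentagons per edge, using at least
two edges of each; so its length is at least `3 * 3 * 2 = 18`. A homomorphism to `C₅` maps each
pentagon bijectively, hence moves by `±2` across it, and `±2 ± 2 ± 2` is never zero modulo five.
So the homomorphism properly colors the original graph.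
-/

open Filter Topology Set
open scoped RealInnerProductSpace EuclideanSpace

section Segments

variable {X E : Type*} [TopologicalSpace X] {x₀ : X}

theorem eventually_disjoint_segment [AddCommGroup E] [Module ℝ E] [TopologicalSpace E]
    [IsTopologicalAddGroup E] [ContinuousSMul ℝ E] [T2Space E] {a b c d : X → E}
    (ha : ContinuousAt a x₀) (hb : ContinuousAt b x₀) (hc : ContinuousAt c x₀)
    (hd : ContinuousAt d x₀)
    (h : Disjoint (segment ℝ (a x₀) (b x₀)) (segment ℝ (c x₀) (d x₀))) :
    ∀ᶠ x in 𝓝 x₀, Disjoint (segment ℝ (a x) (b x)) (segment ℝ (c x) (d x)) := by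
  simp only [segment_eq_image', disjoint_left, mem_image, not_exists, not_and,
    forall_exists_index, and_imp, forall_apply_eq_imp_iff₂] at h ⊢
  have hcompact : IsCompact (Icc (0 : ℝ) 1 ×ˢ Icc (0 : ℝ) 1) := isCompact_Icc.prod isCompact_Icc
  have hne := hcompact.eventually_forall_of_forall_eventually (x₀ := x₀)
    (P := fun x q ↦ c x + q.2 • (d x - c x) ≠ a x + q.1 • (b x - a x)) fun q hq ↦ by
      have hcont : ContinuousAt (fun y : X × ℝ × ℝ ↦ (c y.1 + y.2.2 • (d y.1 - c y.1),
          a y.1 + y.2.1 • (b y.1 - a y.1))) (x₀, q) := by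
        have := ha.comp_of_eq (f := Prod.fst) (x := (x₀, q)) continuousAt_fst rfl
        have := hb.comp_of_eq (f := Prod.fst) (x := (x₀, q)) continuousAt_fst rfl
        have := hc.comp_of_eq (f := Prod.fst) (x := (x₀, q)) continuousAt_fst rfl
        have := hd.comp_of_eq (f := Prod.fst) (x := (x₀, q)) continuousAt_fst rfl
        simp only [Function.comp_def] at *
        fun_prop
      exact hcont.eventually ((isOpen_ne_fun continuous_fst continuous_snd).mem_nhds
        (h _ hq.1 _ hq.2))
  filter_upwards [hne] with x hx t ht r hr using hx (t, r) ⟨ht, hr⟩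

theorem eventually_notMem_segment [AddCommGroup E] [Module ℝ E] [TopologicalSpace E]
    [IsTopologicalAddGroup E] [ContinuousSMul ℝ E] [T2Space E] {a b c : X → E}
    (ha : ContinuousAt a x₀) (hb : ContinuousAt b x₀) (hc : ContinuousAt c x₀)
    (h : c x₀ ∉ segment ℝ (a x₀) (b x₀)) : ∀ᶠ x in 𝓝 x₀, c x ∉ segment ℝ (a x) (b x) := by
  simpa using eventually_disjoint_segment ha hb hc hc (by simpa using h)

theorem not_sameRay_of_segment_inter_subset [AddCommGroup E] [Module ℝ E] {z a b : E}
    (ha : a ≠ z) (hb : b ≠ z) (h : segment ℝ z a ∩ segment ℝ z b ⊆ {z}) :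
    ¬ SameRay ℝ (a - z) (b - z) := by
  intro hray
  obtain ⟨r, q, hr, hq, heq⟩ := hray.exists_pos (sub_ne_zero.2 ha) (sub_ne_zero.2 hb)
  have hmem : z + (r / (r + q)) • (a - z) ∈ segment ℝ z a ∩ segment ℝ z b := by
    simp only [segment_eq_image', mem_inter_iff]
    refine ⟨mem_image_of_mem _ ⟨by positivity, (div_le_one (by positivity)).2 (by linarith)⟩,
      q / (r + q), ⟨by positivity, (div_le_one (by positivity)).2 (by linarith)⟩, ?_⟩
    simp only [div_eq_inv_mul, mul_smul, heq]
  have hzero : (r / (r + q)) • (a - z) = 0 := by simpa using h hmem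
  exact (smul_ne_zero (by positivity) (sub_ne_zero.2 ha)) hzero

theorem segment_inter_subset_of_not_sameRay [AddCommGroup E] [Module ℝ E] {z a b : E}
    (h : ¬ SameRay ℝ (a - z) (b - z)) : segment ℝ z a ∩ segment ℝ z b ⊆ {z} := by
  simp only [segment_eq_image']
  rintro _ ⟨⟨t, ht, rfl⟩, r, hr, heq : z + r • (b - z) = z + t • (a - z)⟩
  by_contra hne
  have ht' : t • (a - z) ≠ 0 := by simpa using hne
  refine h (SameRay.trans (SameRay.sameRay_nonneg_smul_right (a - z) ht.1) ?_ fun h0 ↦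
    absurd h0 ht')
  rw [← add_left_cancel heq]
  exact SameRay.sameRay_nonneg_smul_left (b - z) hr.1

theorem eventually_segment_inter_subset [NormedAddCommGroup E] [NormedSpace ℝ E]
    {z a b : X → E} (hz : ContinuousAt z x₀) (ha : ContinuousAt a x₀) (hb : ContinuousAt b x₀)
    (haz : a x₀ ≠ z x₀) (hbz : b x₀ ≠ z x₀)
    (h : segment ℝ (z x₀) (a x₀) ∩ segment ℝ (z x₀) (b x₀) ⊆ {z x₀}) :
    ∀ᶠ x in 𝓝 x₀, segment ℝ (z x) (a x) ∩ segment ℝ (z x) (b x) ⊆ {z x} := by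
  have hray := not_sameRay_of_segment_inter_subset haz hbz h
  rw [sameRay_iff_norm_smul_eq] at hray
  have hcont : ContinuousAt
      (fun x ↦ ‖a x - z x‖ • (b x - z x) - ‖b x - z x‖ • (a x - z x)) x₀ := by fun_prop
  filter_upwards [hcont.eventually_ne (sub_ne_zero.2 hray)] with x hx
  exact segment_inter_subset_of_not_sameRay
    (sameRay_iff_norm_smul_eq.not.2 (sub_ne_zero.1 hx))

end Segments

section OrientedPlane

variable {E : Type*} [NormedAddCommGroup E] [InnerProductSpace ℝ E]
  [Fact (Module.finrank ℝ E = 2)] (o : Orientation ℝ E (Fin 2))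

theorem exists_areaForm_pos_of_segment_inter_subset {a z b : E} (ha : a ≠ z) (hb : b ≠ z)
    (h : segment ℝ z a ∩ segment ℝ z b ⊆ {z}) :
    ∃ s, 0 < o.areaForm (z - a) s ∧ 0 < o.areaForm (b - z) s := by
  have hinner : ⟪a - z, b - z⟫ < ‖a - z‖ * ‖b - z‖ := by
    rw [inner_lt_norm_mul_iff_real, ne_comm]
    exact fun heq ↦ not_sameRay_of_segment_inter_subset ha hb h (sameRay_iff_norm_smul_eq.2 heq)
  have hu : 0 < ‖a - z‖ := norm_pos_iff.2 (sub_ne_zero.2 ha)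
  have hv : 0 < ‖b - z‖ := norm_pos_iff.2 (sub_ne_zero.2 hb)
  refine ⟨o.rightAngleRotation (‖b - z‖ • (z - a) + ‖a - z‖ • (b - z)), ?_, ?_⟩ <;>
    rw [o.areaForm_rightAngleRotation_right, inner_add_right, inner_smul_right, inner_smul_right,
      real_inner_self_eq_norm_sq, ← neg_sub a z]
  · rw [norm_neg, inner_neg_left]
    nlinarith
  · rw [inner_neg_right, real_inner_comm]
    nlinarith

theorem disjoint_segment_translate_bend {a z b s r : E}
    (hsa : 0 < o.areaForm (z - a) s) (hsb : 0 < o.areaForm (b - z) s)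
    (hrb : 0 ≤ o.areaForm (b - z) r) (hb : b + r ∉ segment ℝ a z)
    (hside : o.areaForm (b - z) (a - z) ≤ 0 ∨ 0 < o.areaForm (z - a) (b - z + r)) :
    Disjoint (segment ℝ a z) (segment ℝ (z + s) (b + r)) := by
  rw [disjoint_left]
  intro x hx hxs
  have hxb : x ≠ b + r := fun h ↦ hb (h ▸ hx)
  obtain ⟨t, q, ht, hq, htq, rfl⟩ := hxs
  have ht : 0 < t := ht.lt_of_ne' fun h0 ↦ hxb (by simp_all)
  rw [segment_symm, segment_eq_image'] at hx
  obtain ⟨p, ⟨hp, -⟩, hx : z + p • (a - z) = _⟩ := hx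
  have hx : p • (a - z) = t • s + q • (b - z + r) := by
    rw [← eq_sub_iff_add_eq'] at hx
    rw [hx, eq_sub_of_add_eq' htq]
    module
  rcases hside with hside | hside
  · have := congrArg (o.areaForm (b - z)) hx
    simp only [map_add, map_smul, smul_eq_mul, o.areaForm_apply_self] at this
    nlinarith [mul_pos ht hsb, mul_nonneg hq hrb]
  · have := congrArg (o.areaForm (z - a)) hx
    rw [← neg_sub z a, map_smul, map_neg, o.areaForm_apply_self, map_add, map_smul, map_smul,
      neg_zero, smul_zero, smul_eq_mul, smul_eq_mul] at this
    linarith [mul_pos ht hsa, mul_nonneg hq hside.le]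

theorem eventually_disjoint_segment_translate_bend {a z b s r : E}
    (hsa : 0 < o.areaForm (z - a) s) (hsb : 0 < o.areaForm (b - z) s)
    (hrb : 0 ≤ o.areaForm (b - z) r) (hb : b ∉ segment ℝ a z) :
    ∀ᶠ ε in 𝓝[>] (0 : ℝ), Disjoint (segment ℝ a z) (segment ℝ (z + ε • s) (b + ε • r)) := by
  have hend : ∀ᶠ ε in 𝓝 (0 : ℝ), b + ε • r ∉ segment ℝ a z :=
    eventually_notMem_segment (a := fun _ ↦ a) (b := fun _ ↦ z) (by fun_prop) (by fun_prop)
      (by fun_prop) (by simpa using hb)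
  have hside : ∀ᶠ ε in 𝓝 (0 : ℝ), o.areaForm (b - z) (a - z) ≤ 0 ∨
      0 < o.areaForm (z - a) (b - z + ε • r) := by
    refine (le_or_gt (o.areaForm (b - z) (a - z)) 0).elim
      (fun h ↦ .of_forall fun _ ↦ .inl h) fun h ↦ ?_
    have hcont : Continuous fun ε : ℝ ↦ o.areaForm (z - a) (b - z + ε • r) := by
      simp only [map_add, map_smul]
      fun_prop
    have h0 : 0 < o.areaForm (z - a) (b - z + (0 : ℝ) • r) := by
      rwa [zero_smul, add_zero, ← neg_sub a z, map_neg, LinearMap.neg_apply,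
        ← o.areaForm_swap]
    filter_upwards [hcont.continuousAt.eventually (lt_mem_nhds h0)] with ε hε using .inr hε
  filter_upwards [nhdsWithin_le_nhds hend, nhdsWithin_le_nhds hside, self_mem_nhdsWithin]
    with ε hbε hside (hε : 0 < ε)
  refine disjoint_segment_translate_bend o ?_ ?_ ?_ hbε hside <;> rw [map_smul, smul_eq_mul]
  exacts [mul_pos hε hsa, mul_pos hε hsb, mul_nonneg hε.le hrb]

theorem eq_end_of_mem_segment_translate {a b s r x : E} {ε : ℝ} (hε : 0 < ε)
    (hs : s = 0 ∨ 0 < o.areaForm (b - a) s) (hr : r = 0 ∨ 0 < o.areaForm (b - a) r)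
    (hsr : s ≠ 0 ∨ r ≠ 0) (hx : x ∈ segment ℝ a b)
    (hxε : x ∈ segment ℝ (a + ε • s) (b + ε • r)) : (s = 0 ∧ x = a) ∨ (r = 0 ∧ x = b) := by
  obtain ⟨t, q, ht, hq, htq, rfl⟩ := hxε
  have harea : t * o.areaForm (b - a) s + q * o.areaForm (b - a) r = 0 := by
    rw [segment_eq_image'] at hx
    obtain ⟨p, -, hx : a + p • (b - a) = _⟩ := hx
    have hx : (p - q) • (b - a) = ε • (t • s + q • r) := by
      rw [← eq_sub_iff_add_eq'] at hx
      rw [sub_smul, hx, eq_sub_of_add_eq htq]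
      module
    have := congrArg (o.areaForm (b - a)) hx
    rw [map_smul, o.areaForm_apply_self, smul_zero, map_smul, map_add, map_smul, map_smul] at this
    exact (smul_eq_zero_iff_right hε.ne').1 this.symm
  rcases hs with rfl | hs <;> rcases hr with rfl | hr
  · simp at hsr
  · have hq0 : q = 0 := by
      simpa only [map_zero, mul_zero, zero_add, mul_eq_zero, hr.ne', or_false] using harea
    exact .inl ⟨rfl, by simp_all⟩
  · have ht0 : t = 0 := by
      simpa only [map_zero, mul_zero, add_zero, mul_eq_zero, hs.ne', or_false] using harea
    exact .inr ⟨rfl, by simp_all⟩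
  · nlinarith [mul_nonneg ht hs.le, mul_nonneg hq hr.le, mul_pos hs hr]

end OrientedPlane

section Chains

variable {E : Type*} [AddCommGroup E] [Module ℝ E] {n : ℕ} {p : ℕ → E}

theorem segment_union_segment_of_mem {a b m : E} (h : m ∈ segment ℝ a b) :
    segment ℝ a m ∪ segment ℝ m b = segment ℝ a b := by
  refine Subset.antisymm (union_subset
    ((convex_segment a b).segment_subset (left_mem_segment ℝ a b) h)
    ((convex_segment a b).segment_subset h (right_mem_segment ℝ a b))) fun x hx ↦ ?_
  rw [mem_segment_iff_wbtw] at h hx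
  obtain ⟨t, ht, rfl⟩ := h
  obtain ⟨r, hr, rfl⟩ := hx
  rcases wbtw_or_wbtw_smul_vadd_of_nonneg a (b - a) hr.1 ht.1 with hw | hw
  · exact .inl hw.mem_segment
  · exact .inr (Wbtw.trans_left_right ⟨r, hr, rfl⟩ hw).mem_segment

theorem segment_inter_segment_subset_of_mem {a b m : E} (h : m ∈ segment ℝ a b) :
    segment ℝ a m ∩ segment ℝ m b ⊆ {m} := by
  rintro x ⟨hxa, hxb⟩
  rw [mem_segment_iff_wbtw] at h hxa hxb
  exact (hxb.swap_left_iff.1 (h.trans_left_right hxa)).symm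

/-- The `i`-th side of the polygonal line with corners `p 0, p 1, …`. -/
def side (p : ℕ → E) (i : ℕ) : Set E :=
  segment ℝ (p i) (p (i + 1))

theorem side_reverse {i : ℕ} (hi : i < n) :
    side (fun i ↦ p (n - i)) i = side p (n - (i + 1)) := by
  rw [side, side, segment_symm, Nat.sub_add_eq, Nat.sub_add_cancel (by lia)]

/-- The polygonal line with corners `p 0, …, p n` does not meet itself. -/
structure IsPolygonalChain (n : ℕ) (p : ℕ → E) : Prop where
  ne : ∀ i < n, p i ≠ p (i + 1)
  meet : ∀ ⦃i j x⦄, i < j → j < n → x ∈ side p i → x ∈ side p j → j = i + 1 ∧ x = p j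

/-- The union of the first `n` sides of a polygonal line. -/
def polyline (n : ℕ) (p : ℕ → E) : Set E :=
  ⋃ i ∈ Iio n, side p i

theorem mem_polyline {x : E} : x ∈ polyline n p ↔ ∃ i < n, x ∈ side p i := by
  simp [polyline]

theorem left_mem_side (p : ℕ → E) (i : ℕ) : p i ∈ side p i :=
  left_mem_segment ℝ _ _

theorem right_mem_side (p : ℕ → E) (i : ℕ) : p (i + 1) ∈ side p i :=
  right_mem_segment ℝ _ _

namespace IsPolygonalChain

theorem eq_or_eq_succ_of_mem_side (h : IsPolygonalChain n p) {i j : ℕ} (hi : i ≤ n) (hj : j < n)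
    (hmem : p i ∈ side p j) : i = j ∨ i = j + 1 := by
  rcases lt_trichotomy i j with hij | hij | hij
  · obtain ⟨rfl, heq⟩ := h.meet hij hj (left_mem_side p i) hmem
    exact absurd heq (h.ne i (by lia))
  · exact .inl hij
  · obtain ⟨m, rfl⟩ := Nat.exists_eq_add_of_lt hij
    by_contra! hne
    have hm := h.meet (by lia : j < j + m) (by lia) hmem (right_mem_side p (j + m))
    exact h.ne _ (by lia) hm.2.symm

theorem injOn (h : IsPolygonalChain n p) : InjOn p (Iic n) := by
  have key : ∀ i j, i < j → j ≤ n → p i ≠ p j := fun i j hij hj heq ↦ by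
    have hmem : p j ∈ side p i := heq ▸ left_mem_side p i
    obtain rfl : j = i + 1 := (h.eq_or_eq_succ_of_mem_side hj (by lia) hmem).resolve_left hij.ne'
    exact h.ne i (by lia) heq
  intro i hi j hj heq
  by_contra hne
  rcases lt_or_gt_of_ne hne with hlt | hlt
  · exact key i j hlt hj heq
  · exact key j i hlt hi heq.symm

theorem slice (h : IsPolygonalChain n p) {a b : ℕ} (hb : b ≤ n) :
    IsPolygonalChain (b - a) (fun i ↦ p (a + i)) where
  ne i hi := h.ne (a + i) (by lia)
  meet i j x hij hj hxi hxj := by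
    obtain ⟨hj', hx⟩ := h.meet (i := a + i) (j := a + j) (by lia) (by lia) hxi hxj
    exact ⟨by lia, hx⟩

theorem reverse (h : IsPolygonalChain n p) : IsPolygonalChain n (fun i ↦ p (n - i)) := by
  refine ⟨fun i hi ↦ ?_, fun i j x hij hj hxi hxj ↦ ?_⟩
  · have hne := h.ne (n - (i + 1)) (by lia)
    rw [show n - (i + 1) + 1 = n - i by lia] at hne
    exact hne.symm
  · rw [side_reverse (by lia)] at hxi hxj
    obtain ⟨hij', hx⟩ := h.meet (by lia) (by lia) hxj hxi
    exact ⟨by lia, by rw [hx]; congr 1; lia⟩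

end IsPolygonalChain

theorem polyline_reverse : polyline n (fun i ↦ p (n - i)) = polyline n p := by
  ext x
  simp only [mem_polyline]
  constructor
  · rintro ⟨i, hi, hx⟩
    exact ⟨n - (i + 1), by lia, (side_reverse hi).subset hx⟩
  · rintro ⟨i, hi, hx⟩
    refine ⟨n - (i + 1), by lia, ?_⟩
    rwa [side_reverse (by lia), show n - (n - (i + 1) + 1) = i by lia]

/-- The corners `p 0, p 1, …` with the midpoint of the first side inserted. -/
noncomputable def insertMidpoint (p : ℕ → E) : ℕ → E
  | 0 => p 0
  | 1 => midpoint ℝ (p 0) (p 1)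
  | i + 2 => p (i + 1)

theorem polyline_insertMidpoint (hn : 1 ≤ n) :
    polyline (n + 1) (insertMidpoint p) = polyline n p := by
  have hunion : side (insertMidpoint p) 0 ∪ side (insertMidpoint p) 1 = side p 0 :=
    segment_union_segment_of_mem (midpoint_mem_segment _ _)
  ext x
  simp only [mem_polyline]
  constructor
  · rintro ⟨_ | _ | i, hi, hx⟩
    · exact ⟨0, hn, hunion ▸ .inl hx⟩
    · exact ⟨0, hn, hunion ▸ .inr hx⟩
    · exact ⟨i + 1, by lia, hx⟩
  · rintro ⟨_ | i, hi, hx⟩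
    · rw [← hunion] at hx
      exact hx.elim (fun h ↦ ⟨0, by lia, h⟩) fun h ↦ ⟨1, by lia, h⟩
    · exact ⟨i + 2, by lia, hx⟩

theorem IsPolygonalChain.insertMidpoint (h : IsPolygonalChain n p) (hn : 1 ≤ n) :
    IsPolygonalChain (n + 1) (insertMidpoint p) := by
  have hne : p 0 ≠ p 1 := h.ne 0 hn
  have hmid : midpoint ℝ (p 0) (p 1) ∈ segment ℝ (p 0) (p 1) := midpoint_mem_segment _ _
  have hright : p 1 ∉ segment ℝ (p 0) (midpoint ℝ (p 0) (p 1)) := fun hmem ↦ hne <| by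
    simpa using segment_inter_segment_subset_of_mem hmid ⟨hmem, right_mem_segment ℝ _ _⟩
  refine ⟨?_, ?_⟩
  · rintro (_ | _ | i) hi
    · simpa [_root_.insertMidpoint] using hne
    · simpa [_root_.insertMidpoint] using hne
    · exact h.ne (i + 1) (by lia)
  · rintro (_ | _ | i) (_ | _ | j) x hij hj hxi hxj
    any_goals lia
    · exact ⟨rfl, segment_inter_segment_subset_of_mem hmid ⟨hxi, hxj⟩⟩
    · obtain ⟨hj', rfl⟩ := h.meet (by lia : 0 < j + 1) (by lia)
        ((convex_segment _ _).segment_subset (left_mem_segment ℝ _ _) hmid hxi) hxj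
      obtain rfl : j = 0 := by lia
      exact absurd hxi hright
    · obtain ⟨hj', rfl⟩ := h.meet (by lia : 0 < j + 1) (by lia)
        ((convex_segment _ _).segment_subset hmid (right_mem_segment ℝ _ _) hxi) hxj
      exact ⟨by lia, rfl⟩
    · obtain ⟨hj', rfl⟩ := h.meet (by lia : i + 1 < j + 1) (by lia) hxi hxj
      exact ⟨by lia, rfl⟩

end Chains

theorem IsPolygonalChain.isPolygonalArc {n : ℕ} {p : ℕ → Plane} (h : IsPolygonalChain n p)
    (hn : 1 ≤ n) : IsPolygonalArc (polyline n p) (p 0) (p n) :=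
  ⟨n, p, hn, rfl, rfl, rfl, h.ne,
    fun i hi ↦ Subset.antisymm (fun _ hx ↦ (h.meet (lt_add_one i) hi hx.1 hx.2).2)
      (singleton_subset_iff.2 ⟨right_mem_side p i, left_mem_side p (i + 1)⟩),
    fun _ _ hij hj ↦ disjoint_left.2 fun _ hxi hxj ↦
      hij.ne' (h.meet (by lia) hj hxi hxj).1⟩

namespace IsPolygonalArc

variable {A : Set Plane} {x y : Plane}

theorem exists_chain (h : IsPolygonalArc A x y) (m : ℕ) :
    ∃ (n : ℕ) (p : ℕ → Plane), m ≤ n ∧ 1 ≤ n ∧ p 0 = x ∧ p n = y ∧ polyline n p = A ∧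
      IsPolygonalChain n p := by
  induction m with
  | zero =>
    obtain ⟨n, p, hn, hx, hy, rfl, hne, hsucc, hdisj⟩ := h
    refine ⟨n, p, n.zero_le, hn, hx, hy, rfl, hne, fun i j z hij hj hzi hzj ↦ ?_⟩
    obtain rfl | hlt := (Nat.succ_le_of_lt hij).eq_or_lt
    · exact ⟨rfl, (hsucc i hj).subset ⟨hzi, hzj⟩⟩
    · exact absurd hzj (disjoint_left.1 (hdisj i j hlt hj) hzi)
  | succ m ih =>
    obtain ⟨n, p, hmn, hn, hx, hy, hA, hp⟩ := ih
    refine ⟨n + 1, insertMidpoint p, by lia, by lia, hx, ?_, (polyline_insertMidpoint hn).trans hA,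
      hp.insertMidpoint hn⟩
    obtain ⟨n, rfl⟩ := Nat.exists_eq_add_of_le' hn
    exact hy

theorem left_mem (h : IsPolygonalArc A x y) : x ∈ A := by
  obtain ⟨n, p, -, hn, rfl, rfl, rfl, -⟩ := h.exists_chain 0
  exact mem_polyline.2 ⟨0, hn, left_mem_side p 0⟩

protected theorem symm (h : IsPolygonalArc A x y) : IsPolygonalArc A y x := by
  obtain ⟨n, p, -, hn, rfl, rfl, rfl, hp⟩ := h.exists_chain 0
  simpa [polyline_reverse] using hp.reverse.isPolygonalArc hn

end IsPolygonalArc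

/-- The points `z 0, …, z (k + 1)` cut the arc `A` into the consecutive arcs `B 0, …, B k`. -/
structure IsArcSubdivision (A : Set Plane) (k : ℕ) (z : ℕ → Plane) (B : ℕ → Set Plane) :
    Prop where
  isPolygonalArc : ∀ i ≤ k, IsPolygonalArc (B i) (z i) (z (i + 1))
  subset : ∀ i ≤ k, B i ⊆ A
  injOn : InjOn z (Iic (k + 1))
  eq_or_eq_succ : ∀ i ≤ k + 1, ∀ j ≤ k, z i ∈ B j → i = j ∨ i = j + 1
  inter_subset : ∀ i j, i < j → j ≤ k → B i ∩ B j ⊆ {z j}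

theorem IsPolygonalArc.exists_isArcSubdivision {A : Set Plane} {x y : Plane}
    (h : IsPolygonalArc A x y) (k : ℕ) :
    ∃ z B, z 0 = x ∧ z (k + 1) = y ∧ IsArcSubdivision A k z B := by
  obtain ⟨n, p, hk, -, hx, hy, rfl, hp⟩ := h.exists_chain (k + 1)
  let cut i := if i ≤ k then i else n
  have hcut : ∀ i ≤ k, cut i < cut (i + 1) := fun i hi ↦ by grind
  have hcutn : ∀ i, cut i ≤ n := fun i ↦ by grind
  have hmono : ∀ i j, i < j → j ≤ k → cut (i + 1) ≤ cut j := fun i j hij hj ↦ by grind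
  let piece i := polyline (cut (i + 1) - cut i) fun l ↦ p (cut i + l)
  have hpiece : ∀ i x, x ∈ piece i → ∃ l, cut i ≤ l ∧ l < cut (i + 1) ∧ x ∈ side p l := by
    intro i x hx
    obtain ⟨l, hl, hx⟩ := mem_polyline.1 hx
    exact ⟨cut i + l, by lia, by lia, hx⟩
  refine ⟨p ∘ cut, piece, by simpa [cut] using hx, by simpa [cut] using hy, ?_, ?_, ?_, ?_, ?_⟩
  · intro i hi
    have := (hp.slice (a := cut i) (hcutn (i + 1))).isPolygonalArc (by have := hcut i hi; lia)
    simpa [Nat.add_sub_cancel' (hcut i hi).le] using this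
  · intro i _ x hx
    obtain ⟨l, -, hl, hx⟩ := hpiece i x hx
    exact mem_polyline.2 ⟨l, hl.trans_le (hcutn _), hx⟩
  · intro i hi j hj heq
    have := hp.injOn (hcutn i) (hcutn j) heq
    grind
  · intro i hi j hj hmem
    obtain ⟨l, hjl, hl, hmem⟩ := hpiece j _ hmem
    have := hp.eq_or_eq_succ_of_mem_side (hcutn i) (hl.trans_le (hcutn _)) hmem
    grind
  · rintro i j hij hj x ⟨hxi, hxj⟩
    obtain ⟨l, _, hl, hxl⟩ := hpiece i x hxi
    obtain ⟨m, hjm, hm, hxm⟩ := hpiece j x hxj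
    have := hmono i j hij hj
    obtain ⟨rfl, rfl⟩ := hp.meet (by lia) (hm.trans_le (hcutn _)) hxl hxm
    rw [show l + 1 = cut j by lia]
    rfl

/-- A multigraph with vertex type `V` and edge type `E`. Loops and parallel edges are allowed; the
direction of an edge from its source to its target is auxiliary. -/
structure Multigraph (V E : Type*) where
  src : E → V
  tgt : E → V

namespace Multigraph

variable {V E : Type*}

/-- The unordered pair of ends of an edge. -/
def ends (M : Multigraph V E) (e : E) : Sym2 V :=
  s(M.src e, M.tgt e)

/-- No edge joins a vertex to itself. -/
def IsLoopless (M : Multigraph V E) : Prop :=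
  ∀ e, M.src e ≠ M.tgt e

/-- The simple graph that forgets loops and multiplicities. -/
def toSimpleGraph (M : Multigraph V E) : SimpleGraph V :=
  SimpleGraph.fromEdgeSet (range M.ends)

/-- A simple graph as a multigraph, each edge being directed by choice. -/
noncomputable def ofSimpleGraph (G : SimpleGraph V) : Multigraph V G.edgeSet where
  src e := (Quot.out e.1).1
  tgt e := (Quot.out e.1).2

theorem ends_ofSimpleGraph (G : SimpleGraph V) (e : G.edgeSet) : (ofSimpleGraph G).ends e = e.1 :=
  Quot.out_eq e.1

theorem adj_ofSimpleGraph (G : SimpleGraph V) (e : G.edgeSet) :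
    G.Adj ((ofSimpleGraph G).src e) ((ofSimpleGraph G).tgt e) := by
  have hmem : (ofSimpleGraph G).ends e ∈ G.edgeSet := (ends_ofSimpleGraph G e).symm ▸ e.2
  exact hmem

theorem toSimpleGraph_adj_ends (M : Multigraph V E) (hM : M.IsLoopless) (e : E) :
    M.toSimpleGraph.Adj (M.src e) (M.tgt e) :=
  (SimpleGraph.fromEdgeSet_adj _).2 ⟨mem_range_self e, hM e⟩

/-- A drawing of `M` in the plane without crossings, with polygonal arcs as edges. -/
structure Drawing (M : Multigraph V E) where
  pos : V → Plane
  arc : E → Set Plane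
  pos_injective : Function.Injective pos
  isPolygonalArc : ∀ e, IsPolygonalArc (arc e) (pos (M.src e)) (pos (M.tgt e))
  mem_ends_of_pos_mem_arc : ∀ e v, pos v ∈ arc e → v ∈ M.ends e
  arc_inter_arc : ∀ e e', e ≠ e' → arc e ∩ arc e' ⊆ range pos

/-- A multigraph is planar if it can be drawn in the plane without crossings. -/
def IsPlanar (M : Multigraph V E) : Prop :=
  Nonempty M.Drawing

theorem isPlanar_ofSimpleGraph {G : SimpleGraph V} (hG : _root_.IsPlanar G) :
    (ofSimpleGraph G).IsPlanar := by
  obtain ⟨D⟩ := hG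
  exact ⟨{
    pos := D.pos
    arc := fun e ↦ D.arc e.1
    pos_injective := D.pos_injective
    isPolygonalArc := fun e ↦ ends_ofSimpleGraph G e ▸ D.isPolygonalArc _ _ (adj_ofSimpleGraph G e)
    mem_ends_of_pos_mem_arc := fun e v hv ↦
      (ends_ofSimpleGraph G e).symm ▸ D.vertex_mem_arc e.1 e.2 v hv
    arc_inter_arc := fun e e' hne ↦
      D.arc_inter_arc e.1 e.2 e'.1 e'.2 (Subtype.coe_injective.ne hne) }⟩

theorem IsPlanar.toSimpleGraph {M : Multigraph V E} (hM : M.IsPlanar) :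
    _root_.IsPlanar M.toSimpleGraph := by
  obtain ⟨D⟩ := hM
  have hends : ∀ s ∈ M.toSimpleGraph.edgeSet, ∃ e, M.ends e = s := fun s hs ↦ by
    rw [Multigraph.toSimpleGraph, SimpleGraph.edgeSet_fromEdgeSet] at hs
    exact hs.1
  choose edge hedge using hends
  classical
  let arc s := if hs : s ∈ M.toSimpleGraph.edgeSet then D.arc (edge s hs) else ∅
  have harc : ∀ s hs, arc s = D.arc (edge s hs) := fun s hs ↦ dif_pos hs
  refine ⟨⟨D.pos, arc, D.pos_injective, fun u v huv ↦ ?_, fun s hs v hv ↦ ?_,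
    fun s hs s' hs' hne ↦ ?_⟩⟩
  · rw [harc _ huv]
    have hpoly := D.isPolygonalArc (edge s(u, v) huv)
    rcases Sym2.eq_iff.1 (hedge s(u, v) huv) with ⟨hu, hv⟩ | ⟨hv, hu⟩
    · rwa [hu, hv] at hpoly
    · rw [hu, hv] at hpoly
      exact hpoly.symm
  · rw [harc s hs] at hv
    exact hedge s hs ▸ D.mem_ends_of_pos_mem_arc _ v hv
  · rw [harc s hs, harc s' hs']
    refine D.arc_inter_arc _ _ fun heq ↦ hne ?_
    rw [← hedge s hs, heq, hedge s' hs']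

section Subdivide

variable (M : Multigraph V E) (k : E → ℕ)

/-- The `i`-th vertex of the path of length `k e + 1` that replaces the edge `e` when it is
subdivided `k e` times. -/
def subdivisionPoint (e : E) : ℕ → V ⊕ Σ e, Fin (k e)
  | 0 => .inl (M.src e)
  | i + 1 => if h : i < k e then .inr ⟨e, i, h⟩ else .inl (M.tgt e)

/-- The multigraph in which every edge `e` is subdivided by `k e` new vertices. -/
def subdivide : Multigraph (V ⊕ Σ e, Fin (k e)) (Σ e, Fin (k e + 1)) where
  src d := M.subdivisionPoint k d.1 d.2
  tgt d := M.subdivisionPoint k d.1 (d.2 + 1)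

variable {M k}

theorem subdivisionPoint_zero (e : E) : M.subdivisionPoint k e 0 = .inl (M.src e) := rfl

theorem subdivisionPoint_succ {e : E} (i : Fin (k e)) :
    M.subdivisionPoint k e (i + 1) = .inr ⟨e, i⟩ := by
  simp [subdivisionPoint]

theorem subdivisionPoint_last (e : E) : M.subdivisionPoint k e (k e + 1) = .inl (M.tgt e) := by
  simp [subdivisionPoint]

theorem mem_ends_subdivide {d : Σ e, Fin (k e + 1)} {i : ℕ} (hi : i = d.2 ∨ i = d.2 + 1) :
    M.subdivisionPoint k d.1 i ∈ (M.subdivide k).ends d :=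
  Sym2.mem_iff.2 (hi.imp (congrArg _) (congrArg _))

theorem Drawing.exists_isArcSubdivision (D : M.Drawing) (k : E → ℕ) :
    ∃ (z : E → ℕ → Plane) (B : E → ℕ → Set Plane),
      (∀ e, IsArcSubdivision (D.arc e) (k e) (z e) (B e)) ∧
      (∀ e, z e 0 = D.pos (M.src e)) ∧ (∀ e, z e (k e + 1) = D.pos (M.tgt e)) ∧
      (∀ e (i : Fin (k e)), z e (i + 1) ∈ D.arc e) ∧
      (∀ e (i : Fin (k e)), z e (i + 1) ∉ range D.pos) := by
  choose z B hz0 hz1 hB using fun e ↦ (D.isPolygonalArc e).exists_isArcSubdivision (k e)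
  have hmem : ∀ e (i : Fin (k e)), z e (i + 1) ∈ D.arc e := fun e i ↦
    (hB e).subset _ (by lia) ((hB e).isPolygonalArc _ (by lia : i + 1 ≤ k e)).left_mem
  refine ⟨z, B, hB, hz0, hz1, hmem, ?_⟩
  rintro e i ⟨v, hv⟩
  rcases Sym2.mem_iff.1 (D.mem_ends_of_pos_mem_arc e v (hv ▸ hmem e i)) with rfl | rfl
  · have := (hB e).injOn (by simp) (by simp) ((hz0 e).trans hv)
    lia
  · have := (hB e).injOn (by simp) (by simp) ((hz1 e).trans hv)
    lia

theorem IsPlanar.subdivide (hM : M.IsPlanar) (k : E → ℕ) : (M.subdivide k).IsPlanar := by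
  obtain ⟨D⟩ := hM
  obtain ⟨z, B, hB, hz0, hz1, hmem, hnew⟩ := D.exists_isArcSubdivision k
  let pos : V ⊕ (Σ e, Fin (k e)) → Plane := Sum.elim D.pos fun x ↦ z x.1 (x.2 + 1)
  have hpos : ∀ e, ∀ i ≤ k e + 1, pos (M.subdivisionPoint k e i) = z e i := by
    rintro e (_ | i) hi
    · exact (hz0 e).symm
    · obtain hlt | rfl := (Nat.le_of_succ_le_succ hi).lt_or_eq
      · exact congrArg pos (subdivisionPoint_succ ⟨i, hlt⟩)
      · rw [subdivisionPoint_last]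
        exact (hz1 e).symm
  have hinj : Function.Injective pos := by
    refine D.pos_injective.sumElim ?_ fun v x hv ↦ hnew x.1 x.2 ⟨v, hv⟩
    rintro ⟨e, i⟩ ⟨e', i'⟩ (heq : z e (i + 1) = z e' (i' + 1))
    obtain rfl | hne := eq_or_ne e e'
    · have := (hB e).injOn (by simp) (by simp) heq
      exact congrArg (Sigma.mk e) (Fin.ext (by lia))
    · exact absurd (D.arc_inter_arc e e' hne ⟨hmem e i, heq ▸ hmem e' i'⟩) (hnew e i)
  have hends : ∀ (d : Σ e, Fin (k e + 1)) v, pos v ∈ D.arc d.1 →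
      ∃ i ≤ k d.1 + 1, M.subdivisionPoint k d.1 i = v := by
    rintro ⟨e, l⟩ (v | ⟨e', i⟩) hv
    · rcases Sym2.mem_iff.1 (D.mem_ends_of_pos_mem_arc e v hv) with rfl | rfl
      · exact ⟨0, by lia, subdivisionPoint_zero e⟩
      · exact ⟨k e + 1, le_rfl, subdivisionPoint_last e⟩
    · obtain rfl | hne := eq_or_ne e e'
      · exact ⟨i + 1, by lia, subdivisionPoint_succ i⟩
      · exact absurd (D.arc_inter_arc e e' hne ⟨hv, hmem e' i⟩) (hnew e' i)
  refine ⟨⟨pos, fun d ↦ B d.1 d.2, hinj, fun d ↦ ?_, fun d v hv ↦ ?_, ?_⟩⟩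
  · have := (hB d.1).isPolygonalArc d.2 (by lia)
    rwa [← hpos d.1 d.2 (by lia), ← hpos d.1 (d.2 + 1) (by lia)] at this
  · obtain ⟨i, hi, rfl⟩ := hends d v ((hB d.1).subset _ (by lia) hv)
    exact mem_ends_subdivide ((hB d.1).eq_or_eq_succ i hi d.2 (by lia) (hpos d.1 i hi ▸ hv))
  · rintro ⟨e, i⟩ ⟨e', i'⟩ hne x ⟨hx, hx'⟩
    obtain rfl | hee := eq_or_ne e e'
    · wlog hlt : i < i' generalizing i i'
      · exact this i' hx' i hne.symm hx
          (lt_of_le_of_ne (not_lt.1 hlt) fun heq ↦ hne (congrArg _ heq.symm))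
      · rw [(hB e).inter_subset i i' hlt (by lia) ⟨hx, hx'⟩, ← hpos e i' (by lia)]
        exact mem_range_self _
    · obtain ⟨v, rfl⟩ := D.arc_inter_arc e e' hee
        ⟨(hB e).subset _ (by lia) hx, (hB e').subset _ (by lia) hx'⟩
      exact ⟨.inl v, rfl⟩

end Subdivide

end Multigraph

theorem IsPlanar.of_injective_hom {V W : Type*} {G : SimpleGraph V} {H : SimpleGraph W}
    (hG : IsPlanar G) (f : H →g G) (hf : Function.Injective f) : IsPlanar H := by
  obtain ⟨D⟩ := hG
  have hedge : ∀ e ∈ H.edgeSet, e.map f ∈ G.edgeSet := fun e he ↦ f.map_mem_edgeSet he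
  refine ⟨⟨D.pos ∘ f, fun e ↦ D.arc (e.map f), D.pos_injective.comp hf,
    fun u v huv ↦ D.isPolygonalArc _ _ (f.map_adj huv), fun e he w hw ↦ ?_,
    fun e he e' he' hne x hx ↦ ?_⟩⟩
  · obtain ⟨u, hu, huw⟩ := Sym2.mem_map.1 (D.vertex_mem_arc _ (hedge e he) _ hw)
    exact hf huw ▸ hu
  · obtain ⟨v, rfl⟩ := D.arc_inter_arc _ (hedge e he) _ (hedge e' he')
      ((Sym2.map.injective hf).ne hne) hx
    obtain ⟨u, -, rfl⟩ := Sym2.mem_map.1 (D.vertex_mem_arc _ (hedge e he) v hx.1)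
    exact ⟨u, rfl⟩

namespace IsPolygonalChain

variable {E X : Type*} {n m : ℕ}

theorem notMem_side [AddCommGroup E] [Module ℝ E] {p : ℕ → E} (h : IsPolygonalChain n p) {i j : ℕ}
    (hi : i ≤ n) (hj : j < n) (hne : i ≠ j) (hne' : i ≠ j + 1) : p i ∉ side p j := fun hmem ↦
  (h.eq_or_eq_succ_of_mem_side hi hj hmem).elim hne hne'

theorem exists_side_eq_segment_of_mem [AddCommGroup E] [Module ℝ E] {p : ℕ → E}
    (h : IsPolygonalChain n p) {v : E} {i : ℕ} (hi : i < n) (hv : v ∈ ({p 0, p n} : Set E))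
    (hmem : v ∈ side p i) :
    ∃ a b, (a = 0 ∨ a = n) ∧ p a = v ∧ p b ≠ v ∧ ∀ q : ℕ → E, side q i = segment ℝ (q a) (q b) := by
  rcases hv with rfl | rfl
  · obtain rfl : 0 = i := by
      simpa using h.eq_or_eq_succ_of_mem_side n.zero_le hi hmem
    exact ⟨0, 1, .inl rfl, rfl, (h.ne 0 hi).symm, fun _ ↦ rfl⟩
  · obtain rfl : n = i + 1 := (h.eq_or_eq_succ_of_mem_side le_rfl hi hmem).resolve_left hi.ne'
    exact ⟨i + 1, i, .inr rfl, rfl, h.ne i hi, fun _ ↦ segment_symm ℝ _ _⟩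

theorem ends_inter_side_subsingleton [AddCommGroup E] [Module ℝ E] {p : ℕ → E}
    (h : IsPolygonalChain n p) (hn : 2 ≤ n) {i : ℕ} (hi : i < n) :
    ({p 0, p n} ∩ side p i : Set E).Subsingleton := by
  have hstart : p 0 ∈ side p i → i = 0 := fun hmem ↦ by
    simpa [eq_comm] using h.eq_or_eq_succ_of_mem_side n.zero_le hi hmem
  have hlast : p n ∈ side p i → i + 1 = n := fun hmem ↦
    ((h.eq_or_eq_succ_of_mem_side le_rfl hi hmem).resolve_left hi.ne').symm
  rintro _ ⟨rfl | rfl, hv⟩ _ ⟨rfl | rfl, hw⟩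
  · rfl
  · have := hstart hv
    have := hlast hw
    lia
  · have := hstart hw
    have := hlast hv
    lia
  · rfl

variable [NormedAddCommGroup E] [NormedSpace ℝ E] [TopologicalSpace X] {x₀ : X}
  {p q : X → ℕ → E}

protected theorem eventually (h : IsPolygonalChain n (p x₀))
    (hp : ∀ i, ContinuousAt (fun x ↦ p x i) x₀) : ∀ᶠ x in 𝓝 x₀, IsPolygonalChain n (p x) := by
  have hne : ∀ᶠ x in 𝓝 x₀, ∀ i ∈ Iio n, p x i ≠ p x (i + 1) :=
    (eventually_all_finite (finite_Iio n)).2 fun i hi ↦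
      (((hp i).sub (hp (i + 1))).eventually_ne (sub_ne_zero.2 (h.ne i hi))).mono
        fun _ ↦ sub_ne_zero.1
  have hmeet : ∀ᶠ x in 𝓝 x₀, ∀ j ∈ Iio n, ∀ i ∈ Iio j, ∀ y,
      y ∈ side (p x) i → y ∈ side (p x) j → j = i + 1 ∧ y = p x j := by
    refine (eventually_all_finite (finite_Iio n)).2 fun j hj ↦
      (eventually_all_finite (finite_Iio j)).2 fun i (hi : i < j) ↦ ?_
    obtain rfl | hij := (Nat.succ_le_of_lt hi).eq_or_lt
    · filter_upwards [eventually_segment_inter_subset (hp (i + 1)) (hp i) (hp (i + 2))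
        (h.ne i (hi.trans hj)) (h.ne (i + 1) hj).symm fun y hy ↦
          (h.meet hi hj ((segment_symm ℝ _ _).subset hy.1) hy.2).2] with x hx y hyi hyj
      exact ⟨rfl, hx ⟨(segment_symm ℝ _ _).subset hyi, hyj⟩⟩
    · have hdisj : Disjoint (side (p x₀) i) (side (p x₀) j) :=
        disjoint_left.2 fun y hyi hyj ↦ hij.ne' (h.meet hi hj hyi hyj).1
      filter_upwards [eventually_disjoint_segment (hp i) (hp (i + 1)) (hp j) (hp (j + 1)) hdisj]
        with x hx y hyi hyj using absurd hyj (disjoint_left.1 hx hyi)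
  filter_upwards [hne, hmeet] with x hne hmeet
  exact ⟨hne, fun i j y hij hj ↦ hmeet j hj i hij y⟩

theorem eventually_inter_subset (hP : IsPolygonalChain n (p x₀)) (hQ : IsPolygonalChain m (q x₀))
    (hn : 2 ≤ n) (hp : ∀ i, ContinuousAt (fun x ↦ p x i) x₀)
    (hq : ∀ i, ContinuousAt (fun x ↦ q x i) x₀)
    (hpend : ∀ x, p x 0 = p x₀ 0 ∧ p x n = p x₀ n) (hqend : ∀ x, q x 0 = q x₀ 0 ∧ q x m = q x₀ m)
    (hmeet : polyline n (p x₀) ∩ polyline m (q x₀) ⊆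
      {p x₀ 0, p x₀ n} ∩ {q x₀ 0, q x₀ m}) :
    ∀ᶠ x in 𝓝 x₀, polyline n (p x) ∩ polyline m (q x) ⊆ {p x₀ 0, p x₀ n} := by
  have hsides : ∀ᶠ x in 𝓝 x₀, ∀ i ∈ Iio n, ∀ j ∈ Iio m,
      side (p x) i ∩ side (q x) j ⊆ {p x₀ 0, p x₀ n} := by
    refine (eventually_all_finite (finite_Iio n)).2 fun i hi ↦
      (eventually_all_finite (finite_Iio m)).2 fun j hj ↦ ?_
    by_cases hdisj : Disjoint (side (p x₀) i) (side (q x₀) j)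
    · filter_upwards [eventually_disjoint_segment (hp i) (hp (i + 1)) (hq j) (hq (j + 1)) hdisj]
        with x hx y hy using absurd hy.2 (disjoint_left.1 hx hy.1)
    have hends : side (p x₀) i ∩ side (q x₀) j ⊆ {p x₀ 0, p x₀ n} ∩ {q x₀ 0, q x₀ m} :=
      fun y hy ↦ hmeet ⟨mem_polyline.2 ⟨i, hi, hy.1⟩, mem_polyline.2 ⟨j, hj, hy.2⟩⟩
    obtain ⟨v, hvp, hvq⟩ := not_disjoint_iff.1 hdisj
    obtain ⟨a, b, ha, hav, hbv, hsp⟩ :=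
      hP.exists_side_eq_segment_of_mem hi (hends ⟨hvp, hvq⟩).1 hvp
    obtain ⟨c, d, hc, hcv, hdv, hsq⟩ :=
      hQ.exists_side_eq_segment_of_mem hj (hends ⟨hvp, hvq⟩).2 hvq
    have hpa : ∀ x, p x a = v := fun x ↦ by
      rcases ha with rfl | rfl
      exacts [(hpend x).1.trans hav, (hpend x).2.trans hav]
    have hqc : ∀ x, q x c = v := fun x ↦ by
      rcases hc with rfl | rfl
      exacts [(hqend x).1.trans hcv, (hqend x).2.trans hcv]
    simp only [hsp, hsq, hpa, hqc] at hends hvp ⊢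
    have hinter : segment ℝ v (p x₀ b) ∩ segment ℝ v (q x₀ d) ⊆ {v} := fun y hy ↦
      hP.ends_inter_side_subsingleton hn hi
        ⟨(hends hy).1, by rw [hsp, hpa]; exact hy.1⟩
        ⟨(hends ⟨hvp, left_mem_segment ℝ _ _⟩).1, by rw [hsp, hpa]; exact hvp⟩
    filter_upwards [eventually_segment_inter_subset (z := fun _ ↦ v) continuousAt_const (hp b)
      (hq d) hbv hdv hinter] with x hx
    exact hx.trans (singleton_subset_iff.2 (hends ⟨hvp, left_mem_segment ℝ _ _⟩).1)
  filter_upwards [hsides] with x hx y ⟨hyp, hyq⟩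
  obtain ⟨i, hi, hyi⟩ := mem_polyline.1 hyp
  obtain ⟨j, hj, hyj⟩ := mem_polyline.1 hyq
  exact hx i hi j hj ⟨hyi, hyj⟩

end IsPolygonalChain

theorem eventually_notMem_polyline {E X : Type*} [AddCommGroup E] [Module ℝ E]
    [TopologicalSpace E] [IsTopologicalAddGroup E] [ContinuousSMul ℝ E] [T2Space E]
    [TopologicalSpace X] {n : ℕ} {p : X → ℕ → E} {x₀ : X} {v : E}
    (hp : ∀ i, ContinuousAt (fun x ↦ p x i) x₀) (hv : v ∉ polyline n (p x₀)) :
    ∀ᶠ x in 𝓝 x₀, v ∉ polyline n (p x) := by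
  simp only [mem_polyline, not_exists, not_and] at hv ⊢
  exact (eventually_all_finite (finite_Iio n)).2 fun i hi ↦
    eventually_notMem_segment (c := fun _ ↦ v) (hp i) (hp (i + 1)) continuousAt_const (hv i hi)

section ParallelChain

variable {E : Type*} [AddCommGroup E] [Module ℝ E] {p s : ℕ → E}

/-- The polygonal line `p` itself for `b = false`, and its parallel copy with all corners moved by
`ε • s` for `b = true`. -/
def parallelChain (p s : ℕ → E) (b : Bool) (ε : ℝ) (l : ℕ) : E :=
  p l + (bif b then ε else 0) • s l

theorem parallelChain_false (ε : ℝ) : parallelChain p s false ε = p := by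
  simp [parallelChain, funext_iff]

theorem parallelChain_zero (b : Bool) : parallelChain p s b 0 = p := by
  simp [parallelChain, funext_iff]

theorem continuous_parallelChain [TopologicalSpace E] [ContinuousAdd E] [ContinuousSMul ℝ E]
    (b : Bool) (l : ℕ) : Continuous fun ε ↦ parallelChain p s b ε l := by
  cases b <;> simp only [parallelChain, cond_true, cond_false] <;> fun_prop

theorem eventually_notMem_polyline_parallelChain [TopologicalSpace E] [IsTopologicalAddGroup E]
    [ContinuousSMul ℝ E] [T2Space E] {n : ℕ} {v : E} (hv : v ∉ polyline n p) (s : ℕ → E)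
    (b : Bool) : ∀ᶠ ε in 𝓝 (0 : ℝ), v ∉ polyline n (parallelChain p s b ε) :=
  eventually_notMem_polyline (x₀ := (0 : ℝ)) (p := parallelChain p s b)
    (fun l ↦ (continuous_parallelChain b l).continuousAt) (by rwa [parallelChain_zero])

end ParallelChain

theorem IsPolygonalChain.eventually_parallelChain {E : Type*} [NormedAddCommGroup E]
    [NormedSpace ℝ E] {n : ℕ} {p : ℕ → E} (h : IsPolygonalChain n p) (s : ℕ → E) (b : Bool) :
    ∀ᶠ ε in 𝓝 (0 : ℝ), IsPolygonalChain n (parallelChain p s b ε) :=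
  IsPolygonalChain.eventually (x₀ := (0 : ℝ)) (p := parallelChain p s b)
    (by rwa [parallelChain_zero]) fun l ↦ (continuous_parallelChain b l).continuousAt

section LeftShift

variable {E : Type*} [NormedAddCommGroup E] [InnerProductSpace ℝ E]
  [Fact (Module.finrank ℝ E = 2)] {o : Orientation ℝ E (Fin 2)} {n : ℕ} {p s : ℕ → E}

/-- The vector `s i` points from the inner corner `p i` of a polygonal line to the left of both
sides at this corner, and `s` vanishes at the two ends. Moving every corner `p i` by a small
positive multiple of `s i` yields a parallel copy of the polygonal line. -/
structure IsLeftShift (o : Orientation ℝ E (Fin 2)) (n : ℕ) (p s : ℕ → E) : Prop where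
  zero : s 0 = 0
  last : s n = 0
  left_of_prev : ∀ i, i + 1 < n → 0 < o.areaForm (p (i + 1) - p i) (s (i + 1))
  left_of_next : ∀ i, i + 1 < n → 0 < o.areaForm (p (i + 2) - p (i + 1)) (s (i + 1))

theorem IsPolygonalChain.exists_isLeftShift (h : IsPolygonalChain n p) :
    ∃ s, IsLeftShift o n p s := by
  have hcorner : ∀ i, ∃ v, i + 1 < n →
      0 < o.areaForm (p (i + 1) - p i) v ∧ 0 < o.areaForm (p (i + 2) - p (i + 1)) v := fun i ↦ by
    by_cases hi : i + 1 < n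
    · obtain ⟨v, hv⟩ := exists_areaForm_pos_of_segment_inter_subset o (h.ne i (by lia))
        (h.ne (i + 1) hi).symm fun y hy ↦
          (h.meet (lt_add_one i) hi ((segment_symm ℝ _ _).subset hy.1) hy.2).2
      exact ⟨v, fun _ ↦ hv⟩
    · exact ⟨0, fun h ↦ absurd h hi⟩
  choose v hv using hcorner
  let s i := if i = 0 ∨ i = n then 0 else v (i - 1)
  have hs : ∀ i, i + 1 < n → s (i + 1) = v i := fun i hi ↦ if_neg (by lia)
  exact ⟨s, if_pos (.inl rfl), if_pos (.inr rfl), fun i hi ↦ hs i hi ▸ (hv i hi).1,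
    fun i hi ↦ hs i hi ▸ (hv i hi).2⟩

namespace IsLeftShift

theorem left_of_start (hs : IsLeftShift o n p s) {i : ℕ} (hi : i < n) :
    i = 0 ∧ s i = 0 ∨ 0 < o.areaForm (p (i + 1) - p i) (s i) := by
  rcases i with _ | i
  · exact .inl ⟨rfl, hs.zero⟩
  · exact .inr (hs.left_of_next i hi)

theorem left_of_finish (hs : IsLeftShift o n p s) {i : ℕ} (hi : i < n) :
    i + 1 = n ∧ s (i + 1) = 0 ∨ 0 < o.areaForm (p (i + 1) - p i) (s (i + 1)) := by
  obtain rfl | hlt := (Nat.succ_le_of_lt hi).eq_or_lt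
  · exact .inl ⟨rfl, hs.last⟩
  · exact .inr (hs.left_of_prev i hlt)

theorem eventually_disjoint_side (hs : IsLeftShift o n p s) (h : IsPolygonalChain n p) {i j : ℕ}
    (hi : i < n) (hj : j < n) (hij : i ≠ j) :
    ∀ᶠ ε in 𝓝[>] (0 : ℝ), Disjoint (side p i) (side (fun l ↦ p l + ε • s l) j) := by
  by_cases hsucc : j = i + 1
  · subst hsucc
    exact eventually_disjoint_segment_translate_bend o (hs.left_of_prev i hj)
      (hs.left_of_next i hj) ((hs.left_of_finish hj).elim (fun h0 ↦ by simp [h0.2]) le_of_lt)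
      (h.notMem_side (i := i + 2) (by lia) hi (by lia) (by lia))
  by_cases hpred : i = j + 1
  · subst hpred
    have hbend := eventually_disjoint_segment_translate_bend (-o) (a := p (j + 2)) (b := p j)
      (z := p (j + 1)) (s := s (j + 1)) (r := s j)
    simp only [o.areaForm_neg_orientation, LinearMap.neg_apply, ← LinearMap.map_neg₂,
      neg_sub] at hbend
    have := hbend (hs.left_of_next j hi) (hs.left_of_prev j hi)
      ((hs.left_of_start hj).elim (fun h0 ↦ by simp [h0.2]) le_of_lt)
      (segment_symm ℝ (p (j + 1)) _ ▸ h.notMem_side hj.le hi (by lia) (by lia))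
    simpa only [side, segment_symm ℝ (p (j + 1) + _), segment_symm ℝ (p (j + 2))] using this
  have hdisj : Disjoint (side p i) (side p j) := disjoint_left.2 fun x hxi hxj ↦ by
    rcases lt_or_gt_of_ne hij with hlt | hlt
    · exact hsucc (h.meet hlt hj hxi hxj).1
    · exact hpred (h.meet hlt hi hxj hxi).1
  exact nhdsWithin_le_nhds (eventually_disjoint_segment (x₀ := (0 : ℝ)) (a := fun _ ↦ p i)
    (b := fun _ ↦ p (i + 1)) (by fun_prop) (by fun_prop) (by fun_prop) (by fun_prop)
    (by simpa [side] using hdisj))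

theorem side_inter_side_subset (hs : IsLeftShift o n p s) (hn : 2 ≤ n) {i : ℕ} (hi : i < n)
    {ε : ℝ} (hε : 0 < ε) : side p i ∩ side (fun l ↦ p l + ε • s l) i ⊆ {p 0, p n} := by
  rintro x ⟨hx, hxε⟩
  have hstart := hs.left_of_start hi
  have hfinish := hs.left_of_finish hi
  have hpos : ∀ v, 0 < o.areaForm (p (i + 1) - p i) v → v ≠ 0 := by
    rintro _ hv rfl
    simp at hv
  rcases eq_end_of_mem_segment_translate o hε (hstart.imp_left And.right)
      (hfinish.imp_left And.right) (by grind) hx hxε with ⟨h0, rfl⟩ | ⟨h0, rfl⟩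
  · exact .inl (by rw [(hstart.resolve_right fun h ↦ hpos _ h h0).1])
  · exact .inr (by rw [(hfinish.resolve_right fun h ↦ hpos _ h h0).1]; rfl)

theorem eventually_inter_subset (hs : IsLeftShift o n p s) (h : IsPolygonalChain n p)
    (hn : 2 ≤ n) : ∀ᶠ ε in 𝓝[>] (0 : ℝ),
      polyline n p ∩ polyline n (fun l ↦ p l + ε • s l) ⊆ {p 0, p n} := by
  have hsides : ∀ᶠ ε in 𝓝[>] (0 : ℝ), ∀ i ∈ Iio n, ∀ j ∈ Iio n,
      side p i ∩ side (fun l ↦ p l + ε • s l) j ⊆ {p 0, p n} := by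
    refine (eventually_all_finite (finite_Iio n)).2 fun i hi ↦
      (eventually_all_finite (finite_Iio n)).2 fun j hj ↦ ?_
    obtain rfl | hij := eq_or_ne i j
    · filter_upwards [self_mem_nhdsWithin] with ε hε using hs.side_inter_side_subset hn hi hε
    · filter_upwards [hs.eventually_disjoint_side h hi hj hij] with ε hε x hx
        using absurd hx.2 (disjoint_left.1 hε hx.1)
  filter_upwards [hsides] with ε hε x ⟨hx, hxε⟩
  obtain ⟨i, hi, hxi⟩ := mem_polyline.1 hx
  obtain ⟨j, hj, hxj⟩ := mem_polyline.1 hxε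
  exact hε i hi j hj ⟨hxi, hxj⟩

theorem parallelChain_start (hs : IsLeftShift o n p s) (b : Bool) (ε : ℝ) :
    parallelChain p s b ε 0 = p 0 := by
  simp [parallelChain, hs.zero]

theorem parallelChain_finish (hs : IsLeftShift o n p s) (b : Bool) (ε : ℝ) :
    parallelChain p s b ε n = p n := by
  simp [parallelChain, hs.last]

theorem eventually_parallelChain_inter_subset (hs : IsLeftShift o n p s)
    (h : IsPolygonalChain n p) (hn : 2 ≤ n) {b b' : Bool} (hb : b ≠ b') : ∀ᶠ ε in 𝓝[>] (0 : ℝ),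
      polyline n (parallelChain p s b ε) ∩ polyline n (parallelChain p s b' ε) ⊆ {p 0, p n} := by
  filter_upwards [hs.eventually_inter_subset h hn] with ε hε
  cases b <;> cases b'
  · exact absurd rfl hb
  · rwa [parallelChain_false]
  · rwa [parallelChain_false, inter_comm]
  · exact absurd rfl hb

theorem eventually_parallelChain_inter_subset_of_inter_subset {m : ℕ} {p' s' : ℕ → E}
    (hs : IsLeftShift o n p s) (hs' : IsLeftShift o m p' s') (h : IsPolygonalChain n p)
    (h' : IsPolygonalChain m p') (hn : 2 ≤ n) (b b' : Bool)
    (hmeet : polyline n p ∩ polyline m p' ⊆ {p 0, p n} ∩ {p' 0, p' m}) : ∀ᶠ ε in 𝓝 (0 : ℝ),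
      polyline n (parallelChain p s b ε) ∩ polyline m (parallelChain p' s' b' ε) ⊆
        {p 0, p n} := by
  have := IsPolygonalChain.eventually_inter_subset (x₀ := (0 : ℝ))
    (p := parallelChain p s b) (q := parallelChain p' s' b') (n := n) (m := m)
  simp only [parallelChain_zero, hs.parallelChain_start, hs.parallelChain_finish,
    hs'.parallelChain_start, hs'.parallelChain_finish] at this
  exact this h h' hn (fun l ↦ (continuous_parallelChain b l).continuousAt)
    (fun l ↦ (continuous_parallelChain b' l).continuousAt) (by simp) (by simp) hmeet

end IsLeftShift

end LeftShift

namespace Multigraph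

variable {V E : Type*} {M : Multigraph V E}

/-- The multigraph in which every edge is replaced by two parallel copies of itself. -/
def double (M : Multigraph V E) : Multigraph V (E × Bool) where
  src d := M.src d.1
  tgt d := M.tgt d.1

theorem Drawing.arc_inter_arc_subset_ends (D : M.Drawing) {e e' : E} (hne : e ≠ e') :
    D.arc e ∩ D.arc e' ⊆ {D.pos (M.src e), D.pos (M.tgt e)} ∩
      {D.pos (M.src e'), D.pos (M.tgt e')} := by
  rintro x ⟨hx, hx'⟩
  obtain ⟨v, rfl⟩ := D.arc_inter_arc e e' hne ⟨hx, hx'⟩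
  exact ⟨(Sym2.mem_iff.1 (D.mem_ends_of_pos_mem_arc e v hx)).imp (congrArg D.pos)
      (congrArg D.pos), (Sym2.mem_iff.1 (D.mem_ends_of_pos_mem_arc e' v hx')).imp
      (congrArg D.pos) (congrArg D.pos)⟩

theorem IsPlanar.double [Finite V] [Finite E] (hM : M.IsPlanar) : M.double.IsPlanar := by
  obtain ⟨D⟩ := hM
  let o := (EuclideanSpace.basisFun (Fin 2) ℝ).toBasis.orientation
  have : Fact (Module.finrank ℝ Plane = 2) := ⟨by simp⟩
  choose n p hn2 hn1 hp0 hpn hpoly hp using fun e ↦ (D.isPolygonalArc e).exists_chain 2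
  choose s hs using fun e ↦ (hp e).exists_isLeftShift (o := o)
  let q (d : E × Bool) := parallelChain (p d.1) (s d.1) d.2
  have hchain : ∀ᶠ ε in 𝓝[>] 0, ∀ d, IsPolygonalChain (n d.1) (q d ε) :=
    eventually_all.2 fun d ↦ nhdsWithin_le_nhds ((hp d.1).eventually_parallelChain _ d.2)
  have hvertex : ∀ᶠ ε in 𝓝[>] 0, ∀ d v, D.pos v ∈ polyline (n d.1) (q d ε) → v ∈ M.ends d.1 := by
    refine eventually_all.2 fun d ↦ eventually_all.2 fun v ↦ ?_
    by_cases hv : v ∈ M.ends d.1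
    · exact .of_forall fun _ _ ↦ hv
    have hoff : D.pos v ∉ polyline (n d.1) (p d.1) :=
      hpoly d.1 ▸ mt (D.mem_ends_of_pos_mem_arc d.1 v) hv
    exact nhdsWithin_le_nhds ((eventually_notMem_polyline_parallelChain hoff _ d.2).mono
      fun ε hε h ↦ absurd h hε)
  have hinter : ∀ᶠ ε in 𝓝[>] 0, ∀ d d', d ≠ d' →
      polyline (n d.1) (q d ε) ∩ polyline (n d'.1) (q d' ε) ⊆ {p d.1 0, p d.1 (n d.1)} := by
    refine eventually_all.2 fun ⟨e, b⟩ ↦ eventually_all.2 fun ⟨e', b'⟩ ↦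
      eventually_imp_distrib_left.2 fun hne ↦ ?_
    obtain rfl | he := eq_or_ne e e'
    · exact (hs e).eventually_parallelChain_inter_subset (hp e) (hn2 e) fun hb ↦
        hne (congrArg _ hb)
    · refine nhdsWithin_le_nhds <| (hs e).eventually_parallelChain_inter_subset_of_inter_subset
        (hs e') (hp e) (hp e') (hn2 e) b b' ?_
      simpa only [hp0, hpn, hpoly] using D.arc_inter_arc_subset_ends he
  obtain ⟨ε, hchain, hvertex, hinter⟩ := (hchain.and (hvertex.and hinter)).exists
  refine ⟨⟨D.pos, fun d ↦ polyline (n d.1) (q d ε), D.pos_injective, fun d ↦ ?_, hvertex,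
    fun d d' hne ↦ (hinter d d' hne).trans ?_⟩⟩
  · have := (hchain d).isPolygonalArc (hn1 d.1)
    simp only [q, (hs d.1).parallelChain_start, (hs d.1).parallelChain_finish, hp0, hpn] at this
    exact this
  · rw [hp0, hpn]
    exact insert_subset (mem_range_self _) (singleton_subset_iff.2 (mem_range_self _))

end Multigraph

namespace Multigraph

variable {V E : Type*} {M : Multigraph V E} {k : E → ℕ} {U : Set E}

theorem subdivisionPoint_eq_inr_iff {e : E} {i : ℕ} {x : Σ e, Fin (k e)} :
    M.subdivisionPoint k e i = .inr x ↔ e = x.1 ∧ i = x.2 + 1 := by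
  obtain ⟨e', l⟩ := x
  rcases i with _ | i
  · simp [subdivisionPoint]
  rw [subdivisionPoint]
  split_ifs with hi
  · simp only [Sum.inr.injEq, Sigma.mk.injEq, add_left_inj]
    refine and_congr_right ?_
    rintro rfl
    exact heq_iff_eq.trans Fin.ext_iff
  · refine iff_of_false id ?_
    rintro ⟨rfl, h⟩
    exact hi (by have := l.2; lia)

theorem subdivisionPoint_eq_inl_iff {e : E} {i : ℕ} {v : V} :
    M.subdivisionPoint k e i = .inl v ↔ i = 0 ∧ M.src e = v ∨ k e < i ∧ M.tgt e = v := by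
  rcases i with _ | i
  · simp [subdivisionPoint]
  rw [subdivisionPoint]
  split_ifs with hi
  · simp [hi]
  · simp [Nat.lt_succ_of_le (not_lt.1 hi)]

theorem inr_mem_ends_subdivide_iff {x : Σ e, Fin (k e)} {d : Σ e, Fin (k e + 1)} :
    .inr x ∈ (M.subdivide k).ends d ↔
      d.1 = x.1 ∧ ((d.2 : ℕ) = x.2 + 1 ∨ (d.2 : ℕ) = x.2) := by
  rw [Multigraph.ends, Sym2.mem_iff, eq_comm, @eq_comm _ (Sum.inr x)]
  simp only [Multigraph.subdivide, subdivisionPoint_eq_inr_iff, add_left_inj, and_or_left]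

theorem inl_mem_ends_subdivide_iff {v : V} {d : Σ e, Fin (k e + 1)} :
    .inl v ∈ (M.subdivide k).ends d ↔
      (d.2 : ℕ) = 0 ∧ M.src d.1 = v ∨ (d.2 : ℕ) = k d.1 ∧ M.tgt d.1 = v := by
  rw [Multigraph.ends, Sym2.mem_iff, eq_comm, @eq_comm _ (Sum.inl v)]
  simp only [Multigraph.subdivide, subdivisionPoint_eq_inl_iff]
  have := d.2.2
  grind

theorem IsLoopless.double (hM : M.IsLoopless) : M.double.IsLoopless :=
  fun d ↦ hM d.1

theorem IsLoopless.injOn_subdivisionPoint (hM : M.IsLoopless) (e : E) :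
    InjOn (M.subdivisionPoint k e) (Iic (k e + 1)) := by
  have := hM e
  intro i hi j hj heq
  rcases i with _ | i <;> rcases j with _ | j <;>
    grind [subdivisionPoint]

theorem IsLoopless.subdivide (hM : M.IsLoopless) (k : E → ℕ) : (M.subdivide k).IsLoopless := by
  rintro ⟨e, i⟩ (heq : M.subdivisionPoint k e i = M.subdivisionPoint k e (i + 1))
  have := hM.injOn_subdivisionPoint e (mem_Iic.2 (by lia)) (mem_Iic.2 (by lia)) heq
  lia

theorem IsLoopless.ends_subdivide_injective (hM : M.IsLoopless) (hk : ∀ e, 1 ≤ k e) :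
    Function.Injective (M.subdivide k).ends := by
  rintro ⟨e, i⟩ ⟨e', i'⟩ heq
  obtain ⟨x, hx⟩ : ∃ x, .inr x ∈ (M.subdivide k).ends ⟨e, i⟩ := by
    by_cases hi : (i : ℕ) = 0
    · exact ⟨⟨e, 0, hk e⟩, inr_mem_ends_subdivide_iff.2 ⟨rfl, .inr hi⟩⟩
    · exact ⟨⟨e, i - 1, by lia⟩, inr_mem_ends_subdivide_iff.2 ⟨rfl, .inl (by lia)⟩⟩
  obtain rfl : e = e' := (inr_mem_ends_subdivide_iff.1 hx).1.trans
    (inr_mem_ends_subdivide_iff.1 (heq ▸ hx)).1.symm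
  have hinj := hM.injOn_subdivisionPoint (k := k) e
  have hii' : (i : ℕ) = i' := by
    obtain ⟨h, -⟩ | ⟨h, h'⟩ :
        M.subdivisionPoint k e i = M.subdivisionPoint k e i' ∧
          M.subdivisionPoint k e (i + 1) = M.subdivisionPoint k e (i' + 1) ∨
        M.subdivisionPoint k e i = M.subdivisionPoint k e (i' + 1) ∧
          M.subdivisionPoint k e (i + 1) = M.subdivisionPoint k e i' := Sym2.eq_iff.1 heq
    · exact hinj (mem_Iic.2 (by lia)) (mem_Iic.2 (by lia)) h
    · have := hinj (mem_Iic.2 (by lia)) (mem_Iic.2 (by lia)) h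
      have := hinj (mem_Iic.2 (by lia)) (mem_Iic.2 (by lia)) h'
      lia
  exact congrArg _ (Fin.ext hii')

/-- Every edge of `U` shares each of its ends with another edge of `U`, so that the subgraph formed
by `U` has no vertex of degree one. Edge sets of cycles have this property, and no proper nonempty
subset of such an edge set does. -/
def IsLeafless (M : Multigraph V E) (U : Set E) : Prop :=
  ∀ e ∈ U, ∀ v ∈ M.ends e, ∃ e' ∈ U, e' ≠ e ∧ v ∈ M.ends e'

theorem IsLeafless.three_le_encard (hU : M.IsLeafless U) (hM : M.IsLoopless)
    (hends : Function.Injective M.ends) (hne : U.Nonempty) : 3 ≤ U.encard := by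
  obtain ⟨e, he⟩ := hne
  obtain ⟨e₁, he₁, hne₁, hsrc⟩ := hU e he (M.src e) (Sym2.mem_mk_left _ _)
  obtain ⟨e₂, he₂, hne₂, htgt⟩ := hU e he (M.tgt e) (Sym2.mem_mk_right _ _)
  have hne₁₂ : e₁ ≠ e₂ := fun heq ↦
    hne₁ (hends ((Sym2.mem_and_mem_iff (hM e)).1 ⟨hsrc, heq ▸ htgt⟩))
  calc (3 : ℕ∞) = ({e, e₁, e₂} : Set E).encard :=
        (encard_eq_three.2 ⟨e, e₁, e₂, hne₁.symm, hne₂.symm, hne₁₂, rfl⟩).symm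
    _ ≤ U.encard := encard_le_encard (by simp [insert_subset_iff, he, he₁, he₂])

theorem encard_preimage_fst_singleton (k : E → ℕ) (e : E) :
    (Sigma.fst ⁻¹' {e} : Set (Σ e, Fin (k e + 1))).encard = k e + 1 := by
  rw [← range_sigmaMk, ← image_univ, sigma_mk_injective.encard_image]
  simp

theorem mul_encard_le_encard_preimage_fst {m : ℕ} (hk : ∀ e, m ≤ k e + 1) (U : Set E) :
    m * U.encard ≤ (Sigma.fst ⁻¹' U : Set (Σ e, Fin (k e + 1))).encard := by
  let f (x : Fin m × E) : Σ e, Fin (k e + 1) := ⟨x.2, x.1.castLE (hk x.2)⟩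
  have hf : Function.Injective f := by
    rintro ⟨i, e⟩ ⟨i', e'⟩ heq
    simp only [f, Sigma.mk.injEq] at heq
    obtain ⟨rfl, heq⟩ := heq
    simpa using heq
  calc (m : ℕ∞) * U.encard = ((univ : Set (Fin m)) ×ˢ U).encard := by simp [encard_prod]
    _ ≤ _ := encard_le_encard_of_injOn (f := f) (fun x hx ↦ hx.2) hf.injOn

theorem IsLeafless.preimage_fst (hU : M.IsLeafless U) :
    (M.subdivide k).IsLeafless (Sigma.fst ⁻¹' U) := by
  rintro ⟨e, i⟩ (he : e ∈ U) (v | ⟨e', l⟩) hv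
  · have hve : v ∈ M.ends e := Sym2.mem_iff.2
      ((inl_mem_ends_subdivide_iff.1 hv).imp (·.2.symm) (·.2.symm))
    obtain ⟨e', he', hne, hve'⟩ := hU e he v hve
    rcases Sym2.mem_iff.1 hve' with rfl | rfl
    · exact ⟨⟨e', 0⟩, he', by simp [hne], inl_mem_ends_subdivide_iff.2 (.inl ⟨rfl, rfl⟩)⟩
    · exact ⟨⟨e', Fin.last _⟩, he', by simp [hne],
        inl_mem_ends_subdivide_iff.2 (.inr ⟨rfl, rfl⟩)⟩
  · obtain ⟨rfl, hi | hi⟩ := inr_mem_ends_subdivide_iff.1 hv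
    · exact ⟨⟨_, l.castSucc⟩, he, by
        simp only [ne_eq, Sigma.mk.injEq, heq_eq_eq, Fin.ext_iff, Fin.val_castSucc, true_and]
        grind,
        inr_mem_ends_subdivide_iff.2 ⟨rfl, .inr rfl⟩⟩
    · exact ⟨⟨_, l.succ⟩, he, by
        simp only [ne_eq, Sigma.mk.injEq, heq_eq_eq, Fin.ext_iff, Fin.val_succ, true_and]
        grind,
        inr_mem_ends_subdivide_iff.2 ⟨rfl, .inl rfl⟩⟩

theorem IsLeafless.mk_mem_iff {U : Set (Σ e, Fin (k e + 1))} (hU : (M.subdivide k).IsLeafless U)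
    {e : E} (i : Fin (k e + 1)) : ⟨e, i⟩ ∈ U ↔ ⟨e, 0⟩ ∈ U := by
  induction i using Fin.induction with
  | zero => rfl
  | succ i ih =>
    rw [← ih]
    constructor <;> intro hi
    · obtain ⟨⟨e', j⟩, hj, hne, hmem⟩ := hU _ hi (.inr ⟨e, i⟩)
        (inr_mem_ends_subdivide_iff.2 ⟨rfl, .inl rfl⟩)
      obtain ⟨rfl, h | h⟩ := inr_mem_ends_subdivide_iff.1 hmem
      · exact absurd (congrArg _ (Fin.ext h)) hne
      · rwa [show j = i.castSucc from Fin.ext h] at hj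
    · obtain ⟨⟨e', j⟩, hj, hne, hmem⟩ := hU _ hi (.inr ⟨e, i⟩)
        (inr_mem_ends_subdivide_iff.2 ⟨rfl, .inr rfl⟩)
      obtain ⟨rfl, h | h⟩ := inr_mem_ends_subdivide_iff.1 hmem
      · rwa [show j = i.succ from Fin.ext h] at hj
      · exact absurd (congrArg _ (Fin.ext h)) hne

theorem IsLeafless.exists_eq_preimage_fst {U : Set (Σ e, Fin (k e + 1))}
    (hU : (M.subdivide k).IsLeafless U) (hM : M.IsLoopless) :
    ∃ U₀, M.IsLeafless U₀ ∧ U = Sigma.fst ⁻¹' U₀ := by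
  have hmem : ∀ e, ∀ i : Fin (k e + 1), ⟨e, i⟩ ∈ U ↔ ⟨e, 0⟩ ∈ U := fun e i ↦ hU.mk_mem_iff i
  refine ⟨{e | (⟨e, 0⟩ : Σ e, Fin (k e + 1)) ∈ U}, fun e he v hv ↦ ?_, ext fun ⟨e, i⟩ ↦ hmem e i⟩
  obtain ⟨i, hi⟩ : ∃ i, .inl v ∈ (M.subdivide k).ends ⟨e, i⟩ := by
    rcases Sym2.mem_iff.1 hv with rfl | rfl
    · exact ⟨0, inl_mem_ends_subdivide_iff.2 (.inl ⟨rfl, rfl⟩)⟩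
    · exact ⟨Fin.last _, inl_mem_ends_subdivide_iff.2 (.inr ⟨rfl, rfl⟩)⟩
  obtain ⟨⟨e', i'⟩, he', hne, hi'⟩ := hU _ ((hmem e i).2 he) _ hi
  rw [inl_mem_ends_subdivide_iff] at hi hi'
  refine ⟨e', (hmem e' i').1 he', ?_, Sym2.mem_iff.2 (hi'.imp (·.2.symm) (·.2.symm))⟩
  rintro rfl
  have := hM e'
  have hii' : (i' : ℕ) = i := by grind
  exact hne (congrArg _ (Fin.ext hii'))

theorem isLeafless_double_preimage_fst (M : Multigraph V E) (e : E) :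
    M.double.IsLeafless (Prod.fst ⁻¹' {e}) := by
  rintro ⟨_, b⟩ rfl v hv
  exact ⟨(_, !b), rfl, by simp, hv⟩

theorem IsLeafless.image_fst {U : Set (E × Bool)} (hU : M.double.IsLeafless U)
    (hinj : InjOn Prod.fst U) : M.IsLeafless (Prod.fst '' U) := by
  rintro _ ⟨d, hd, rfl⟩ v hv
  obtain ⟨d', hd', hne, hv'⟩ := hU d hd v hv
  exact ⟨d'.1, mem_image_of_mem _ hd', hinj.ne hd' hd hne, hv'⟩

end Multigraph

theorem exists_preimage_fst_subset_of_not_injOn {E : Type*} {U : Set (E × Bool)}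
    (hU : ¬InjOn Prod.fst U) : ∃ e, Prod.fst ⁻¹' {e} ⊆ U := by
  simp only [InjOn, not_forall] at hU
  obtain ⟨⟨e, b⟩, hb, ⟨_, b'⟩, hb', rfl, hne⟩ := hU
  refine ⟨e, ?_⟩
  rintro ⟨_, b''⟩ rfl
  cases b <;> cases b' <;> cases b'' <;> simp_all

namespace Multigraph

section Cycle

variable {V E : Type*} {M : Multigraph V E} {U : Set E} {u : V} {c : M.toSimpleGraph.Walk u u}

/-- The edges of `M` that underlie the edges of a walk in the simple graph of `M`. -/
def walkEdges (c : M.toSimpleGraph.Walk u u) : Set E :=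
  M.ends ⁻¹' c.edgeSet

theorem edgeSet_toSimpleGraph_subset (M : Multigraph V E) :
    M.toSimpleGraph.edgeSet ⊆ range M.ends := by
  rw [toSimpleGraph, SimpleGraph.edgeSet_fromEdgeSet]
  exact sdiff_subset

theorem encard_walkEdges (hends : Function.Injective M.ends) (hc : c.IsCycle) :
    (walkEdges c).encard = c.length := by
  classical
  have hsub : c.edgeSet ⊆ range M.ends := fun s hs ↦
    M.edgeSet_toSimpleGraph_subset (c.edges_subset_edgeSet hs)
  have hedges : c.edgeSet = c.edges.toFinset := by
    ext
    simp
  rw [walkEdges, encard_preimage_of_injective_subset_range hends hsub, hedges,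
    encard_coe_eq_coe_finsetCard, List.toFinset_card_of_nodup hc.edges_nodup, c.length_edges]

theorem exists_mem_walkEdges_of_adj {v w : V} (h : c.toSubgraph.Adj v w) :
    ∃ e ∈ walkEdges c, M.ends e = s(v, w) := by
  have hmem := SimpleGraph.Walk.adj_toSubgraph_iff_mem_edges.1 h
  obtain ⟨e, he⟩ := M.edgeSet_toSimpleGraph_subset (c.edges_subset_edgeSet hmem)
  exact ⟨e, show M.ends e ∈ c.edges from he ▸ hmem, he⟩

theorem exists_adj_of_mem_walkEdges {e : E} (he : e ∈ walkEdges c) {v : V} (hv : v ∈ M.ends e) :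
    ∃ w, M.ends e = s(v, w) ∧ c.toSubgraph.Adj v w := by
  obtain ⟨w, hw⟩ := hv
  exact ⟨w, hw, SimpleGraph.Walk.adj_toSubgraph_iff_mem_edges.2 (hw ▸ he)⟩

theorem isLeafless_walkEdges (hc : c.IsCycle) : M.IsLeafless (walkEdges c) := by
  intro e he v hv
  obtain ⟨w, hw, hadj⟩ := exists_adj_of_mem_walkEdges he hv
  have hcard := hc.ncard_neighborSet_toSubgraph_eq_two
    (c.mem_verts_toSubgraph.1 (c.toSubgraph.edge_vert hadj))
  obtain ⟨w', hadj', hne⟩ := exists_ne_of_one_lt_ncard (by rw [hcard]; exact one_lt_two) w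
  obtain ⟨e', he', hw'⟩ := exists_mem_walkEdges_of_adj hadj'
  refine ⟨e', he', ?_, hw' ▸ Sym2.mem_mk_left _ _⟩
  rintro rfl
  exact hne (Sym2.congr_right.1 (hw'.symm.trans hw))

theorem IsLeafless.mem_of_mem_walkEdges (hU : M.IsLeafless U) (hends : Function.Injective M.ends)
    (hc : c.IsCycle) (hsub : U ⊆ walkEdges c) {e e₁ : E} {v : V} (he : e ∈ walkEdges c)
    (hv : v ∈ M.ends e) (he₁ : e₁ ∈ U) (hv₁ : v ∈ M.ends e₁) : e ∈ U := by
  obtain ⟨e₂, he₂, hne, hv₂⟩ := hU e₁ he₁ v hv₁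
  obtain ⟨w, hw, hadj⟩ := exists_adj_of_mem_walkEdges he hv
  obtain ⟨w₁, hw₁, hadj₁⟩ := exists_adj_of_mem_walkEdges (hsub he₁) hv₁
  obtain ⟨w₂, hw₂, hadj₂⟩ := exists_adj_of_mem_walkEdges (hsub he₂) hv₂
  have hw₁₂ : w₁ ≠ w₂ := by
    rintro rfl
    exact hne (hends (hw₂.trans hw₁.symm))
  have hcard := hc.ncard_neighborSet_toSubgraph_eq_two
    (c.mem_verts_toSubgraph.1 (c.toSubgraph.edge_vert hadj))
  have hnbr : {w₁, w₂} = c.toSubgraph.neighborSet v :=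
    eq_of_subset_of_ncard_le (insert_subset hadj₁ (singleton_subset_iff.2 hadj₂))
      (by rw [hcard, ncard_pair hw₁₂]) (finite_of_ncard_ne_zero (by rw [hcard]; exact two_ne_zero))
  rcases hnbr.symm.subset hadj with rfl | rfl
  · rwa [hends (hw.trans hw₁.symm)]
  · rwa [hends (hw.trans hw₂.symm)]

theorem IsLeafless.eq_walkEdges (hU : M.IsLeafless U) (hends : Function.Injective M.ends)
    (hc : c.IsCycle) (hsub : U ⊆ walkEdges c) (hne : U.Nonempty) : U = walkEdges c := by
  classical
  refine hsub.antisymm fun e he ↦ ?_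
  let W := {v | ∃ e ∈ U, v ∈ M.ends e}
  obtain ⟨e₀, he₀⟩ := hne
  have hsrc₀ : M.src e₀ ∈ c.support := c.fst_mem_support_of_mem_edges (hsub he₀)
  have hsrc : M.src e ∈ (c.rotate _ hsrc₀).support :=
    (c.mem_support_rotate_iff _ hsrc₀).2 (c.fst_mem_support_of_mem_edges he)
  by_contra heU
  have hW : M.src e ∉ W := fun ⟨e₁, he₁, hv₁⟩ ↦
    heU (hU.mem_of_mem_walkEdges hends hc hsub he (Sym2.mem_mk_left _ _) he₁ hv₁)
  obtain ⟨d, hd, ⟨e₁, he₁, hfst⟩, hsnd⟩ :=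
    ((c.rotate _ hsrc₀).takeUntil _ hsrc).exists_boundary_dart W
      ⟨e₀, he₀, Sym2.mem_mk_left _ _⟩ hW
  have hdc : d ∈ c.darts := (c.rotate_darts _ hsrc₀).mem_iff.1
    ((c.rotate _ hsrc₀).darts_takeUntil_subset_darts hsrc hd)
  obtain ⟨e₂, he₂, hw₂⟩ := exists_mem_walkEdges_of_adj
    (SimpleGraph.Walk.adj_toSubgraph_iff_mem_edges.2 (List.mem_map_of_mem hdc))
  exact hsnd ⟨e₂, hU.mem_of_mem_walkEdges hends hc hsub he₂ (hw₂ ▸ Sym2.mem_mk_left _ _) he₁ hfst,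
    hw₂ ▸ Sym2.mem_mk_right _ _⟩

end Cycle

section Pentagon

variable {V E : Type*} {M : Multigraph V E}

/-- The number of new vertices on each of the two copies of an edge that form a pentagon: one copy
becomes a path of length two, the other one a path of length three. -/
def pentagonVertices (d : E × Bool) : ℕ :=
  if d.2 then 2 else 1

/-- The multigraph in which every edge of `M` is replaced by a pentagon in which the ends of the
edge are at distance two. -/
def pentagonize (M : Multigraph V E) :
    Multigraph (V ⊕ Σ d : E × Bool, Fin (pentagonVertices d))
      (Σ d : E × Bool, Fin (pentagonVertices d + 1)) :=
  M.double.subdivide pentagonVertices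

theorem one_le_pentagonVertices (d : E × Bool) : 1 ≤ pentagonVertices d := by
  rw [pentagonVertices]
  split <;> simp

theorem IsLoopless.pentagonize (hM : M.IsLoopless) : M.pentagonize.IsLoopless :=
  hM.double.subdivide _

theorem IsLoopless.ends_pentagonize_injective (hM : M.IsLoopless) :
    Function.Injective M.pentagonize.ends :=
  hM.double.ends_subdivide_injective one_le_pentagonVertices

theorem IsPlanar.pentagonize [Finite V] [Finite E] (hM : M.IsPlanar) : M.pentagonize.IsPlanar :=
  hM.double.subdivide _

theorem IsLoopless.exists_pentagon (hM : M.IsLoopless) (e : E) :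
    ∃ x y z, M.pentagonize.toSimpleGraph.Adj (.inl (M.src e)) x ∧
      M.pentagonize.toSimpleGraph.Adj x (.inl (M.tgt e)) ∧
      M.pentagonize.toSimpleGraph.Adj (.inl (M.src e)) y ∧
      M.pentagonize.toSimpleGraph.Adj y z ∧
      M.pentagonize.toSimpleGraph.Adj z (.inl (M.tgt e)) ∧
      [.inl (M.src e), x, .inl (M.tgt e), z, y].Nodup := by
  have adj := M.pentagonize.toSimpleGraph_adj_ends hM.pentagonize
  refine ⟨.inr ⟨(e, false), 0, Nat.one_pos⟩, .inr ⟨(e, true), 0, Nat.two_pos⟩,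
    .inr ⟨(e, true), 1, Nat.one_lt_two⟩, adj ⟨(e, false), 0⟩, adj ⟨(e, false), (1 : Fin 2)⟩,
    adj ⟨(e, true), 0⟩, adj ⟨(e, true), (1 : Fin 3)⟩, adj ⟨(e, true), (2 : Fin 3)⟩, ?_⟩
  simp [hM e, Fin.ext_iff]

theorem IsLoopless.exists_isCycle_length_eq_five (hM : M.IsLoopless) (e : E) :
    ∃ (v : _) (c : M.pentagonize.toSimpleGraph.Walk v v), c.IsCycle ∧ c.length = 5 := by
  obtain ⟨x, y, z, hsx, hxt, hsy, hyz, hzt, hnodup⟩ := hM.exists_pentagon e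
  refine ⟨_, .cons hsx (.cons hxt (.cons hzt.symm (.cons hyz.symm (.cons hsy.symm .nil)))), ?_, rfl⟩
  rw [SimpleGraph.Walk.isCycle_def, SimpleGraph.Walk.isTrail_def]
  refine ⟨?_, by simp, ?_⟩
  · simp only [SimpleGraph.Walk.edges_cons, SimpleGraph.Walk.edges_nil, List.nodup_cons,
      List.mem_cons, Sym2.eq_iff]
    grind
  · simp only [SimpleGraph.Walk.support_cons, SimpleGraph.Walk.support_nil, List.tail_cons]
    grind

theorem encard_preimage_pentagonVertices (e : E) :
    (Sigma.fst ⁻¹' (Prod.fst ⁻¹' {e}) :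
      Set (Σ d : E × Bool, Fin (pentagonVertices d + 1))).encard = 5 := by
  have hcopies : (Prod.fst ⁻¹' {e} : Set (E × Bool)) = {(e, false)} ∪ {(e, true)} := by
    ext ⟨e', b⟩
    cases b <;> simp
  rw [hcopies, preimage_union, encard_union_eq, encard_preimage_fst_singleton,
    encard_preimage_fst_singleton]
  · norm_num [pentagonVertices]
  · exact (disjoint_singleton.2 (by simp)).preimage _

theorem IsLoopless.length_eq_five_or_exists_isLeafless (hM : M.IsLoopless) {v}
    {c : M.pentagonize.toSimpleGraph.Walk v v} (hc : c.IsCycle) :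
    c.length = 5 ∨ ∃ U : Set E, M.IsLeafless U ∧ U.Nonempty ∧ 2 * U.encard ≤ c.length := by
  have hends := hM.ends_pentagonize_injective
  have hlength := encard_walkEdges hends hc
  have hne : (walkEdges c).Nonempty := by
    rw [← encard_ne_zero, hlength]
    exact_mod_cast (hc.three_le_length.trans_lt' three_pos).ne'
  obtain ⟨U, hU, hcU⟩ := (isLeafless_walkEdges hc).exists_eq_preimage_fst hM.double
  by_cases hinj : InjOn Prod.fst U
  · refine .inr ⟨Prod.fst '' U, hU.image_fst hinj,
      (nonempty_of_nonempty_preimage (hcU ▸ hne)).image _, ?_⟩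
    rw [hinj.encard_image, ← hlength, hcU]
    exact mul_encard_le_encard_preimage_fst
      (fun d ↦ Nat.succ_le_succ (one_le_pentagonVertices d)) U
  · obtain ⟨e, he⟩ := exists_preimage_fst_subset_of_not_injOn hinj
    have hpentagon : Sigma.fst ⁻¹' (Prod.fst ⁻¹' {e}) = walkEdges c :=
      (M.isLeafless_double_preimage_fst e).preimage_fst.eq_walkEdges hends hc
        (hcU ▸ preimage_mono he) ⟨⟨(e, false), 0⟩, rfl⟩
    rw [← hpentagon, encard_preimage_pentagonVertices] at hlength
    exact .inl (by exact_mod_cast hlength.symm)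

/-- The multigraph in which every edge of `M` is replaced by a chain of three pentagons. -/
def pentagonChain (M : Multigraph V E) :
    Multigraph ((V ⊕ Σ _ : E, Fin 2) ⊕ Σ d : (Σ _ : E, Fin 3) × Bool, Fin (pentagonVertices d))
      (Σ d : (Σ _ : E, Fin 3) × Bool, Fin (pentagonVertices d + 1)) :=
  (M.subdivide fun _ ↦ 2).pentagonize

theorem IsLoopless.length_eq_five_or_eighteen_le (hM : M.IsLoopless)
    (hends : Function.Injective M.ends) {v} {c : M.pentagonChain.toSimpleGraph.Walk v v}
    (hc : c.IsCycle) : c.length = 5 ∨ 18 ≤ c.length := by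
  refine ((hM.subdivide _).length_eq_five_or_exists_isLeafless hc).imp_right ?_
  rintro ⟨U, hU, hne, hle⟩
  obtain ⟨U₀, hU₀, rfl⟩ := hU.exists_eq_preimage_fst hM
  have hU₀card := hU₀.three_le_encard hM hends (nonempty_of_nonempty_preimage hne)
  have hUcard := mul_encard_le_encard_preimage_fst (k := fun _ : E ↦ 2) (fun _ ↦ le_rfl) U₀
  have h18 : (18 : ℕ∞) ≤ c.length := calc
    (18 : ℕ∞) = 2 * (3 * 3) := by norm_num
    _ ≤ 2 * (3 * U₀.encard) := by gcongr
    _ ≤ c.length := (mul_le_mul_right hUcard 2).trans hle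
  exact_mod_cast h18

theorem IsLoopless.egirth_pentagonChain [Nonempty E] (hM : M.IsLoopless)
    (hends : Function.Injective M.ends) : M.pentagonChain.toSimpleGraph.egirth = 5 := by
  refine le_antisymm ?_ (SimpleGraph.le_egirth.2 fun v c hc ↦ ?_)
  · obtain ⟨v, c, hc, hlength⟩ :=
      (hM.subdivide fun _ ↦ 2).exists_isCycle_length_eq_five ⟨Classical.arbitrary E, 0⟩
    exact (SimpleGraph.egirth_le_length hc).trans_eq (congrArg _ hlength)
  · have hlength := hM.length_eq_five_or_eighteen_le hends hc
    exact_mod_cast (by lia : 5 ≤ c.length)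

theorem IsLoopless.noCycleOfLength_pentagonChain (hM : M.IsLoopless)
    (hends : Function.Injective M.ends) {m : ℕ} (hm : m ≤ 17) :
    NoCycleOfLength M.pentagonChain.toSimpleGraph 6 m := by
  rintro v c hc ⟨hlow, hhigh⟩
  have := hM.length_eq_five_or_eighteen_le hends hc
  lia

theorem eq_add_two_or_eq_add_three_of_pentagon {a b c d f : Fin 5}
    (hab : (SimpleGraph.cycleGraph 5).Adj a b) (hbc : (SimpleGraph.cycleGraph 5).Adj b c)
    (had : (SimpleGraph.cycleGraph 5).Adj a d) (hdf : (SimpleGraph.cycleGraph 5).Adj d f)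
    (hfc : (SimpleGraph.cycleGraph 5).Adj f c) : c = a + 2 ∨ c = a + 3 := by
  simp only [SimpleGraph.cycleGraph_adj] at hab hbc had hdf hfc
  decide +revert

theorem IsLoopless.hom_pentagonize_eq (hM : M.IsLoopless)
    (φ : M.pentagonize.toSimpleGraph →g SimpleGraph.cycleGraph 5) (e : E) :
    φ (.inl (M.tgt e)) = φ (.inl (M.src e)) + 2 ∨
      φ (.inl (M.tgt e)) = φ (.inl (M.src e)) + 3 := by
  obtain ⟨x, y, z, hsx, hxt, hsy, hyz, hzt, -⟩ := hM.exists_pentagon e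
  exact eq_add_two_or_eq_add_three_of_pentagon (φ.map_adj hsx) (φ.map_adj hxt) (φ.map_adj hsy)
    (φ.map_adj hyz) (φ.map_adj hzt)

theorem IsLoopless.hom_pentagonChain_ne (hM : M.IsLoopless)
    (φ : M.pentagonChain.toSimpleGraph →g SimpleGraph.cycleGraph 5) (e : E) :
    φ (.inl (.inl (M.src e))) ≠ φ (.inl (.inl (M.tgt e))) := by
  have hstep (i : Fin 3) := (hM.subdivide fun _ ↦ 2).hom_pentagonize_eq φ ⟨e, i⟩
  have hsum : ∀ a b c d : Fin 5, (b = a + 2 ∨ b = a + 3) → (c = b + 2 ∨ c = b + 3) →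
      (d = c + 2 ∨ d = c + 3) → a ≠ d := by decide
  exact hsum _ _ _ _ (hstep 0) (hstep 1) (hstep 2)

end Pentagon

end Multigraph

theorem exists_steinbergProperty {k n : ℕ} (h : steinbergNumber k ≤ n) :
    ∃ m ≤ n, SteinbergProperty k m := by
  have hlt : steinbergNumber k < (n + 1 : ℕ) := h.trans_lt (by exact_mod_cast Nat.lt_succ_self n)
  rw [steinbergNumber] at hlt
  simp only [iInf_lt_iff] at hlt
  obtain ⟨m, hm, hlt⟩ := hlt
  exact ⟨m, Nat.lt_succ_iff.1 (by exact_mod_cast hlt), hm⟩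

theorem SteinbergProperty.colorable_five {m : ℕ} (hS : SteinbergProperty 5 m) (hm : m ≤ 17)
    {V : Type} [Finite V] {G : SimpleGraph V} (hG : IsPlanar G) : G.Colorable 5 := by
  cases isEmpty_or_nonempty G.edgeSet with
  | inl hE => exact ⟨.mk (fun _ ↦ 0) fun hadj ↦ (hE.false ⟨s(_, _), hadj⟩).elim⟩
  | inr hE =>
    let M := Multigraph.ofSimpleGraph G
    have hloop : M.IsLoopless := fun e ↦ (Multigraph.adj_ofSimpleGraph G e).ne
    have hends : M.ends = Subtype.val := funext (Multigraph.ends_ofSimpleGraph G)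
    have hinj : Function.Injective M.ends := hends ▸ Subtype.val_injective
    have hplanar : M.pentagonChain.IsPlanar :=
      ((Multigraph.isPlanar_ofSimpleGraph hG).subdivide _).pentagonize
    obtain ⟨φ⟩ := hS _ _ hplanar.toSimpleGraph (hloop.egirth_pentagonChain hinj)
      (hloop.noCycleOfLength_pentagonChain hinj hm)
    refine ⟨.mk (fun v ↦ φ (.inl (.inl v))) fun {v w} hadj ↦ ?_⟩
    have hne := hloop.hom_pentagonChain_ne φ ⟨s(v, w), hadj⟩
    rcases Sym2.eq_iff.1 (congrFun hends ⟨s(v, w), hadj⟩) with ⟨hv, hw⟩ | ⟨hw, hv⟩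
    · rwa [hv, hw] at hne
    · rw [hv, hw] at hne
      exact hne.symm

theorem mainTheorem4 (hf : steinbergNumber 5 ≤ 17) {V : Type*} [Finite V] (G : SimpleGraph V)
    (hG : IsPlanar G) : G.Colorable 5 := by
  classical
  obtain ⟨m, hm, hS⟩ := exists_steinbergProperty (n := 17) hf
  have := Fintype.ofFinite V
  let φ := G.overFinIso rfl
  have hplanar : IsPlanar (G.overFin rfl) := hG.of_injective_hom φ.symm.toHom φ.symm.injective
  exact (hS.colorable_five hm hplanar).of_hom φ.toHom
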